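/- Let $\mathbb F$ be a field and let $q\in\mathbb F$ be nonzero and not a root of unity. Put $[3]_q=(q^3-q^{-3})/(q-q^{-1})$. Let $\square_q$ be the unital associative $\mathbb F$-algebra with generators $x_i$ $(i\in\mathbb Z/4\mathbb Z)$ and relations, for all $i\in\mathbb Z/4\mathbb Z$, $$\frac{q x_i x_{i+1}-q^{-1}x_{i+1}x_i}{q-q^{-1}}=1,\qquad x_i^3x_{i+2}-[3]_q\,x_i^2x_{i+2}x_i+[3]_q\,x_ix_{i+2}x_i^2-x_{i+2}x_i^3=0.$$ A vector $\xi$ of a $\square_q$-module $V$ is called NIL if $x_1\xi=0$, $x_3\xi=0$ and $\xi\neq 0$. We say that $\xi$ generates $V$ if no proper $\square_q$-submodule of $V$ contains $\xi$, and $V$ is called NIL if it is generated by a NIL vector. A NIL $\square_q$-module exists, and any two NIL $\square_q$-modules are isomorphic. Let $\mathbf U$ denote a NIL $\square_q$-module. Then $\mathbf U$ has a unique sequence of $\mathbb F$-subspaces $\{\mathbf U_n\}_{n\in\mathbb N}$, $\mathbb N=\{0,1,2,\ldots\}$, such that (i) $\mathbf U_0\neq 0$; (ii) the sum $\mathbf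 U=\sum_{n\in\mathbb N}\mathbf U_n$ is direct; (iii) for all $n\in\mathbb N$, $x_0\mathbf U_n\subseteq\mathbf U_{n+1}$, $x_1\mathbf U_n\subseteq\mathbf U_{n-1}$, $x_2\mathbf U_n\subseteq\mathbf U_{n+1}$, $x_3\mathbf U_n\subseteq\mathbf U_{n-1}$, where $\mathbf U_{-1}=0$. Moreover, $\mathbf U_0$ has dimension $1$; the nonzero vectors in $\mathbf U_0$ are precisely the NIL vectors in $\mathbf U$, and each of these vectors generates $\mathbf U$. If $\xi$ is a NIL vector in $\mathbf U$, then for every $n\in\mathbb N$ the subspace $\mathbf U_n$ is spanned by the vectors $u_1u_2\cdots u_n\xi$ with $u_i\in\{x_0,x_2\}$ for $1\le i\le n$. -/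

import Mathlib

universe u v w

/-- The `q`-integer `[n]_q = (q^n - q^{-n}) / (q - q^{-1})`. -/
def qInt {F : Type u} [Field F] (q : F) (n : ℤ) : F :=
  (q ^ n - q ^ (-n)) / (q - q⁻¹)

/-- The defining relations of `□_q` on the free algebra with generators indexed by `ℤ/4ℤ`. -/
inductive SquareRel (F : Type u) [Field F] (q : F) :
    FreeAlgebra F (ZMod 4) → FreeAlgebra F (ZMod 4) → Prop
  | qWeyl (i : ZMod 4) :
      SquareRel F q
        ((q - q⁻¹)⁻¹ •
          (q • (FreeAlgebra.ι F i * FreeAlgebra.ι F (i + 1))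
            - q⁻¹ • (FreeAlgebra.ι F (i + 1) * FreeAlgebra.ι F i)))
        1
  | qSerre (i : ZMod 4) :
      SquareRel F q
        (FreeAlgebra.ι F i ^ 3 * FreeAlgebra.ι F (i + 2)
          - qInt q 3 • (FreeAlgebra.ι F i ^ 2 * FreeAlgebra.ι F (i + 2) * FreeAlgebra.ι F i)
          + qInt q 3 • (FreeAlgebra.ι F i * FreeAlgebra.ι F (i + 2) * FreeAlgebra.ι F i ^ 2)
          - FreeAlgebra.ι F (i + 2) * FreeAlgebra.ι F i ^ 3)
        0

/-- The algebra `□_q`. -/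
abbrev SquareAlgebra (F : Type u) [Field F] (q : F) : Type u :=
  RingQuot (SquareRel F q)

/-- The generators `x_i` of `□_q`, for `i ∈ ℤ/4ℤ`. -/
def SquareAlgebra.x (F : Type u) [Field F] (q : F) (i : ZMod 4) : SquareAlgebra F q :=
  RingQuot.mkAlgHom F (SquareRel F q) (FreeAlgebra.ι F i)

section Modules

variable (F : Type u) [Field F] (q : F)
variable {V : Type v} [AddCommGroup V] [Module F V] [Module (SquareAlgebra F q) V]

/-- The `□_q`-module `V` is generated by `ξ`: no proper `□_q`-submodule contains `ξ`. -/
def IsGeneratedBy (ξ : V) : Prop :=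
  ∀ W : Submodule (SquareAlgebra F q) V, ξ ∈ W → W = ⊤

/-- NIL vectors: nonzero vectors sent to zero by `x_1` and `x_3`. -/
def IsNILVector (ξ : V) : Prop :=
  SquareAlgebra.x F q 1 • ξ = 0 ∧ SquareAlgebra.x F q 3 • ξ = 0 ∧ ξ ≠ 0

variable (V) in
/-- NIL modules: those generated by a NIL vector. -/
def IsNILModule : Prop :=
  ∃ ξ : V, IsNILVector F q ξ ∧ IsGeneratedBy F q ξ

variable {F} in
/-- The subspace `U_{n-1}`, with the convention `U_{-1} = 0`. -/
def prevSubspace (U : ℕ → Submodule F V) : ℕ → Submodule F V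
  | 0 => ⊥
  | n + 1 => U n

/-- The conditions on a sequence of subspaces `U_n`: `U_0` is nonzero, `V` is the direct sum of
the `U_n`, the generators `x_0`, `x_2` raise the index by one, and `x_1`, `x_3` lower it by one. -/
structure IsNILDecomposition (U : ℕ → Submodule F V) : Prop where
  zero_ne_bot : U 0 ≠ ⊥
  isInternal : DirectSum.IsInternal U
  x_zero_smul_mem : ∀ n, ∀ y ∈ U n, SquareAlgebra.x F q 0 • y ∈ U (n + 1)
  x_one_smul_mem : ∀ n, ∀ y ∈ U n, SquareAlgebra.x F q 1 • y ∈ prevSubspace U n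
  x_two_smul_mem : ∀ n, ∀ y ∈ U n, SquareAlgebra.x F q 2 • y ∈ U (n + 1)
  x_three_smul_mem : ∀ n, ∀ y ∈ U n, SquareAlgebra.x F q 3 • y ∈ prevSubspace U n

/-- The vectors `u_1 u_2 ⋯ u_n ξ` with each `u_i` one of `x_0`, `x_2`. -/
def wordVectors (ξ : V) (n : ℕ) : Set V :=
  {y | ∃ u : Fin n → SquareAlgebra F q,
    (∀ i, u i = SquareAlgebra.x F q 0 ∨ u i = SquareAlgebra.x F q 2) ∧
      y = (List.ofFn u).prod • ξ}

end Modules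

/-! The module is realized on the positive part `QPos` of quantum affine sl2: `x_0` and `x_2` act by
left multiplication by the two generators, and `x_1`, `x_3` act by skew derivations `lower k`, the
only choice compatible with the `q`-Weyl relations and with killing `1`. A NIL vector of any module
gives an orbit map from `QPos`, which is equivariant. Existence, uniqueness and the description of
NIL vectors then all rest on `QPos.eq_counit_of_lower_eq_zero`: a vector killed by both `lower k` is
a scalar.

That lemma has two ingredients. Firstly, `lower k` is a combination of the left derivation `derL k`
and the right derivation `derR (!k)`. If both `lower k` kill `v`, a left derivation of `v` can be
traded for a right one, so the constant terms of iterated derivatives of `v` are unchanged, up to a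
scalar, under rotating the word and swapping its letters. Two full turns restore a word of length
`n` with total factor `q ^ (-4n)`, so these constant terms vanish for `n > 0`.

Secondly, the left derivations have only scalars as common kernel
(`QPos.eq_counit_of_derL_eq_zero`); equivalently, the Serre relations exhaust the radical of the
bilinear form on the free algebra. By induction on length, a `v` killed by all `derL k` and without
constant term is primitive for the braided coproduct, so the antipode negates it and its square
fixes it. The right derivations kill `v` too. Each homogeneous component of `v` is thus a lowest
weight vector for both copies of quantum sl2; the copies act locally finitely by the Serre
relations, which leaves only degrees `(n, n)`. There the squared antipode is `q ^ (-4n)`, so `n =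
0`.

The decomposition consists of the spans of words of fixed length applied to a NIL vector. They are
independent as eigenspaces of a scaling operator. Any other decomposition has NIL vectors in degree
zero, hence contains these spans degree by degree, hence equals them. -/

/-- The cubic `q`-Serre expression in two elements of an algebra. -/
def qSerre {F : Type u} [Field F] (q : F) {R : Type v} [Ring R] [Algebra F R] (a b : R) : R :=
  a ^ 3 * b - qInt q 3 • (a ^ 2 * b * a) + qInt q 3 • (a * b * a ^ 2) - b * a ^ 3

/-- The relations of the positive part of `U_q(\hat{sl}_2)`. -/
inductive QPosRel (F : Type u) [Field F] (q : F) :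
    FreeAlgebra F Bool → FreeAlgebra F Bool → Prop
  | serre (i : Bool) : QPosRel F q (qSerre q (FreeAlgebra.ι F i) (FreeAlgebra.ι F (!i))) 0

/-- The positive part of `U_q(\hat{sl}_2)`. -/
def QPos (F : Type u) [Field F] (q : F) : Type u := RingQuot (QPosRel F q)

instance (F : Type u) [Field F] (q : F) : Ring (QPos F q) :=
  inferInstanceAs (Ring (RingQuot (QPosRel F q)))

instance (F : Type u) [Field F] (q : F) : Algebra F (QPos F q) :=
  inferInstanceAs (Algebra F (RingQuot (QPosRel F q)))

/-- `q` to the power of the symmetric bilinear form on the simple roots. -/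
def rootTwist {F : Type u} [Field F] (q : F) (i j : Bool) : F :=
  if i = j then q ^ 2 else (q ^ 2)⁻¹

/-! ### Stability of the `q`-Serre relation under sums, skew commutation and triangular matrices. -/

section Serre

variable {F : Type u} [Field F] {q : F} {R : Type v} [Ring R] [Algebra F R]
  {R' : Type w} [Ring R'] [Algebra F R']

theorem qInt_three (h0 : q ≠ 0) (h2 : q ^ 2 ≠ 1) : qInt q 3 = q ^ 2 + 1 + (q ^ 2)⁻¹ := by
  have h : q ^ 2 - 1 ≠ 0 := sub_ne_zero.2 h2
  have h' : q - q⁻¹ ≠ 0 := by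
    intro h'
    apply h
    have : q * (q - q⁻¹) = 0 := by rw [h', mul_zero]
    rw [mul_sub, mul_inv_cancel₀ h0] at this
    rw [← this]; ring
  have e : q ^ (-3 : ℤ) = (q ^ 3)⁻¹ := by rw [zpow_neg]; norm_cast
  have e' : q ^ (3 : ℤ) = q ^ 3 := by norm_cast
  unfold qInt
  rw [e, e', div_eq_iff h']
  field_simp
  ring

theorem qSerre_smul (a b : F) (x y : R) : qSerre q (a • x) (b • y) = (a ^ 3 * b) • qSerre q x y := by
  simp only [qSerre, pow_succ, pow_zero, one_mul, smul_mul_assoc, mul_smul_comm, smul_smul,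
    mul_assoc]
  module

theorem map_qSerre (φ : R →ₐ[F] R') (x y : R) : φ (qSerre q x y) = qSerre q (φ x) (φ y) := by
  simp [qSerre]

/-- The Serre relation survives a sum of two solutions that `q`-commute in the manner of a
braided tensor product. -/
theorem qSerre_add (h0 : q ≠ 0) (h2 : q ^ 2 ≠ 1) {a b a' b' : R}
    (haa : a' * a = q ^ 2 • (a * a')) (hab : a' * b = (q ^ 2)⁻¹ • (b * a'))
    (hba : b' * a = (q ^ 2)⁻¹ • (a * b'))
    (h : qSerre q a b = 0) (h' : qSerre q a' b' = 0) : qSerre q (a + a') (b + b') = 0 := by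
  have haa' : ∀ z, a' * (a * z) = q ^ 2 • (a * (a' * z)) := fun z => by
    rw [← mul_assoc, haa, smul_mul_assoc, mul_assoc]
  have hab' : ∀ z, a' * (b * z) = (q ^ 2)⁻¹ • (b * (a' * z)) := fun z => by
    rw [← mul_assoc, hab, smul_mul_assoc, mul_assoc]
  have hba' : ∀ z, b' * (a * z) = (q ^ 2)⁻¹ • (a * (b' * z)) := fun z => by
    rw [← mul_assoc, hba, smul_mul_assoc, mul_assoc]
  have key : qSerre q (a + a') (b + b') = qSerre q a b + qSerre q a' b' := by
    simp only [qSerre, qInt_three h0 h2, pow_succ, pow_zero, one_mul, mul_add, add_mul, mul_assoc,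
      haa, hab, hba, haa', hab', hba', smul_mul_assoc, mul_smul_comm, smul_smul, smul_add]
    match_scalars <;> field_simp <;> ring
  rw [key, h, h', add_zero]

/-- The Serre expression of two elements that act as skew derivations on `L` is again skew. -/
theorem qSerre_mul_skew (h0 : q ≠ 0) (h2 : q ^ 2 ≠ 1) {x y l : R} {c d : F}
    (hx : x * l = q ^ 2 • (l * x) + c • 1) (hy : y * l = (q ^ 2)⁻¹ • (l * y) + d • 1) :
    qSerre q x y * l = (q ^ 2) ^ 2 • (l * qSerre q x y) := by
  have hx' : ∀ z, x * (l * z) = q ^ 2 • (l * (x * z)) + c • z := fun z => by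
    rw [← mul_assoc, hx, add_mul, smul_mul_assoc, mul_assoc, smul_mul_assoc, one_mul]
  have hy' : ∀ z, y * (l * z) = (q ^ 2)⁻¹ • (l * (y * z)) + d • z := fun z => by
    rw [← mul_assoc, hy, add_mul, smul_mul_assoc, mul_assoc, smul_mul_assoc, one_mul]
  simp only [qSerre, qInt_three h0 h2, pow_succ, pow_zero, one_mul, mul_add, add_mul, mul_sub,
    sub_mul, mul_assoc, hx, hy, hx', hy', smul_mul_assoc, mul_smul_comm, smul_smul, smul_add,
    smul_sub, mul_one]
  match_scalars <;> field_simp <;> ring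

theorem qSerre_mul_skew' (h0 : q ≠ 0) (h2 : q ^ 2 ≠ 1) {x y l : R} {c d : F}
    (hx : x * l = (q ^ 2)⁻¹ • (l * x) + c • 1) (hy : y * l = q ^ 2 • (l * y) + d • 1) :
    qSerre q x y * l = ((q ^ 2)⁻¹) ^ 2 • (l * qSerre q x y) := by
  have hx' : ∀ z, x * (l * z) = (q ^ 2)⁻¹ • (l * (x * z)) + c • z := fun z => by
    rw [← mul_assoc, hx, add_mul, smul_mul_assoc, mul_assoc, smul_mul_assoc, one_mul]
  have hy' : ∀ z, y * (l * z) = q ^ 2 • (l * (y * z)) + d • z := fun z => by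
    rw [← mul_assoc, hy, add_mul, smul_mul_assoc, mul_assoc, smul_mul_assoc, one_mul]
  simp only [qSerre, qInt_three h0 h2, pow_succ, pow_zero, one_mul, mul_add, add_mul, mul_sub,
    sub_mul, mul_assoc, hx, hy, hx', hy', smul_mul_assoc, mul_smul_comm, smul_smul, smul_add,
    smul_sub, mul_one]
  match_scalars <;> field_simp <;> ring

theorem lowerTriangular_mul (a b c a' b' c' : R) :
    !![a, 0; b, c] * !![a', 0; b', c'] = !![a * a', 0; b * a' + c * b', c * c'] := by
  rw [Matrix.mul_fin_two]; simp

theorem lowerTriangular_add (a b c a' b' c' : R) :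
    !![a, 0; b, c] + !![a', 0; b', c'] = !![a + a', 0; b + b', c + c'] := by
  ext i j; fin_cases i <;> fin_cases j <;> simp

theorem lowerTriangular_sub (a b c a' b' c' : R) :
    !![a, 0; b, c] - !![a', 0; b', c'] = !![a - a', 0; b - b', c - c'] := by
  ext i j; fin_cases i <;> fin_cases j <;> simp

theorem lowerTriangular_smul (r : F) (a b c : R) :
    r • !![a, 0; b, c] = !![r • a, 0; r • b, r • c] := by
  ext i j; fin_cases i <;> fin_cases j <;> simp

/-- The lower left entry is the value of a skew derivation on the Serre expression. It vanishes
because `[3]_q = q ^ 2 + 1 + q ^ (-2)` is the coefficient that cancels the twists; hence skew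
derivations descend to the Serre quotient. -/
theorem qSerre_lowerTriangular (h0 : q ≠ 0) (h2 : q ^ 2 ≠ 1) (x y : R) (c d t u : F)
    (h : t = q ^ 2 ∧ u = (q ^ 2)⁻¹ ∨ t = (q ^ 2)⁻¹ ∧ u = q ^ 2) :
    qSerre q !![x, 0; c • 1, t • x] !![y, 0; d • 1, u • y] =
      !![qSerre q x y, 0; 0, (t ^ 3 * u) • qSerre q x y] := by
  rw [← qSerre_smul]
  simp only [qSerre, qInt_three h0 h2, pow_succ, pow_zero, one_mul, lowerTriangular_mul,
    lowerTriangular_add, lowerTriangular_sub, lowerTriangular_smul]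
  congr 4
  rcases h with ⟨rfl, rfl⟩ | ⟨rfl, rfl⟩ <;>
  · simp only [mul_add, add_mul, mul_assoc, smul_mul_assoc, mul_smul_comm, smul_smul, smul_add,
      mul_one, one_mul]
    match_scalars <;> field_simp <;> ring

end Serre

/-! ### The positive part: universal property, word induction, weight automorphisms. -/

namespace QPos

variable {F : Type u} [Field F] {q : F}

/-- The quotient map from the free algebra. -/
def ofFree (F : Type u) [Field F] (q : F) : FreeAlgebra F Bool →ₐ[F] QPos F q :=
  RingQuot.mkAlgHom F (QPosRel F q)

theorem ofFree_surjective : Function.Surjective (ofFree F q) :=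
  RingQuot.mkAlgHom_surjective F _

/-- The generators of the positive part. -/
def gen (F : Type u) [Field F] (q : F) (i : Bool) : QPos F q :=
  ofFree F q (FreeAlgebra.ι F i)

theorem qSerre_gen (i : Bool) : qSerre q (gen F q i) (gen F q (!i)) = 0 := by
  have : ofFree F q _ = ofFree F q _ :=
    RingQuot.mkAlgHom_rel F (QPosRel.serre (F := F) (q := q) i)
  rwa [map_qSerre, map_zero] at this

section Lift

variable {R : Type v} [Ring R] [Algebra F R]

/-- The universal property of the positive part. -/
def lift (g : Bool → R) (h : ∀ i, qSerre q (g i) (g (!i)) = 0) : QPos F q →ₐ[F] R :=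
  RingQuot.liftAlgHom F ⟨FreeAlgebra.lift F g, by
    rintro _ _ ⟨i⟩
    rw [map_qSerre, map_zero, FreeAlgebra.lift_ι_apply, FreeAlgebra.lift_ι_apply, h]⟩

@[simp]
theorem lift_gen (g : Bool → R) (h : ∀ i, qSerre q (g i) (g (!i)) = 0) (i : Bool) :
    lift g h (gen F q i) = g i :=
  (RingQuot.liftAlgHom_mkAlgHom_apply F _ _ _).trans (FreeAlgebra.lift_ι_apply _ _)

end Lift

theorem adjoin_gen : Algebra.adjoin F (Set.range (gen F q)) = ⊤ := by
  have h := congrArg (Subalgebra.map (ofFree F q))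
    (FreeAlgebra.adjoin_range_ι F Bool)
  rw [AlgHom.map_adjoin, ← Set.range_comp, Algebra.map_top] at h
  rw [show gen F q = ofFree F q ∘ FreeAlgebra.ι F from rfl, h]
  exact (AlgHom.range_eq_top _).2 ofFree_surjective

/-- Induction on words, built up by multiplication on the left. -/
theorem induction_left {P : QPos F q → Prop} (one : P 1) (add : ∀ a b, P a → P b → P (a + b))
    (smul : ∀ (c : F) a, P a → P (c • a)) (gen_mul : ∀ i a, P a → P (gen F q i * a))
    (w : QPos F q) : P w := by
  have key : ∀ w : QPos F q, ∀ a, P a → P (w * a) := by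
    intro w
    have hw : w ∈ Algebra.adjoin F (Set.range (gen F q)) := by rw [adjoin_gen]; trivial
    induction hw using Algebra.adjoin_induction with
    | mem x hx => obtain ⟨i, rfl⟩ := hx; exact gen_mul i
    | algebraMap c => intro a ha; rw [← Algebra.smul_def]; exact smul c a ha
    | add x y _ _ hx hy => intro a ha; rw [add_mul]; exact add _ _ (hx a ha) (hy a ha)
    | mul x y _ _ hx hy => intro a ha; rw [mul_assoc]; exact hx _ (hy a ha)
  simpa using key w 1 one

/-- Induction on words, built up by multiplication on the right. -/
theorem induction_right {P : QPos F q → Prop} (one : P 1) (add : ∀ a b, P a → P b → P (a + b))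
    (smul : ∀ (c : F) a, P a → P (c • a)) (mul_gen : ∀ i a, P a → P (a * gen F q i))
    (w : QPos F q) : P w := by
  have key : ∀ w : QPos F q, ∀ a, P a → P (a * w) := by
    intro w
    have hw : w ∈ Algebra.adjoin F (Set.range (gen F q)) := by rw [adjoin_gen]; trivial
    induction hw using Algebra.adjoin_induction with
    | mem x hx => obtain ⟨i, rfl⟩ := hx; exact mul_gen i
    | algebraMap c =>
      intro a ha; rw [← Algebra.commutes, ← Algebra.smul_def]; exact smul c a ha
    | add x y _ _ hx hy => intro a ha; rw [mul_add]; exact add _ _ (hx a ha) (hy a ha)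
    | mul x y _ _ hx hy => intro a ha; rw [← mul_assoc]; exact hy _ (hx a ha)
  simpa using key w 1 one

/-- Two linear maps agree if they agree at `1` and satisfy the same recursion on words. -/
theorem linearMap_ext {M : Type v} [AddCommGroup M] [Module F M] {f g : QPos F q →ₗ[F] M}
    (one : f 1 = g 1) (gen_mul : ∀ i a, f a = g a → f (gen F q i * a) = g (gen F q i * a)) :
    f = g := by
  ext w
  induction w using induction_left with
  | one => exact one
  | add a b ha hb => rw [map_add, map_add, ha, hb]
  | smul c a ha => rw [map_smul, map_smul, ha]
  | gen_mul i a ha => exact gen_mul i a ha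

/-- The weight automorphism `K_k`. -/
def twist (k : Bool) : QPos F q →ₐ[F] QPos F q :=
  lift (fun j => rootTwist q k j • gen F q j) fun i => by
    rw [qSerre_smul, qSerre_gen, smul_zero]

@[simp]
theorem twist_gen (k j : Bool) : twist k (gen F q j) = rootTwist q k j • gen F q j := by
  simp [twist]

/-- The augmentation. -/
def counit : QPos F q →ₐ[F] F :=
  lift (fun _ => 0) fun i => by simp [qSerre]

@[simp]
theorem counit_gen (i : Bool) : counit (gen F q i) = 0 := by simp [counit]

end QPos

/-- A nonzero scalar that is not a root of unity. -/
class IsGenericParam {F : Type u} [Field F] (q : F) : Prop where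
  ne_zero : q ≠ 0
  pow_ne_one : ∀ n : ℕ, 0 < n → q ^ n ≠ 1

namespace QPos

open TensorProduct

variable {F : Type u} [Field F] {q : F}

section Twist

theorem rootTwist_self (i : Bool) : rootTwist q i i = q ^ 2 := if_pos rfl

theorem rootTwist_not (i : Bool) : rootTwist q i (!i) = (q ^ 2)⁻¹ := if_neg (by simp)

theorem rootTwist_not' (i : Bool) : rootTwist q (!i) i = (q ^ 2)⁻¹ := if_neg (by simp)

theorem rootTwist_comm (i j : Bool) : rootTwist q i j = rootTwist q j i := by
  simp only [rootTwist, eq_comm]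

theorem twist_comm (i j : Bool) (w : QPos F q) : twist i (twist j w) = twist j (twist i w) := by
  induction w using induction_left with
  | one => simp
  | add a b ha hb => simp [ha, hb]
  | smul c a ha => simp [ha]
  | gen_mul k a ha =>
    simp only [map_mul, twist_gen, map_smul, ha, smul_smul, mul_comm]

variable [IsGenericParam q]

theorem _root_.IsGenericParam.sq_ne_one : q ^ 2 ≠ 1 :=
  IsGenericParam.pow_ne_one 2 two_pos

theorem sq_ne_zero' : q ^ 2 ≠ 0 := pow_ne_zero 2 IsGenericParam.ne_zero

theorem rootTwist_mul_not (i j : Bool) : rootTwist q i j * rootTwist q (!i) j = 1 := by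
  have h : q ^ 2 ≠ 0 := sq_ne_zero'
  cases i <;> cases j <;> simp [rootTwist, h]

end Twist

/-! ### Skew derivations of the positive part. -/

section SkewDer

variable [IsGenericParam q]

/-- The matrix representation whose lower left entry is a skew derivation. -/
def skewMatrix (k : Bool) (c : Bool → F) :
    QPos F q →ₐ[F] Matrix (Fin 2) (Fin 2) (QPos F q) :=
  lift (fun j => !![gen F q j, 0; c j • 1, rootTwist q k j • gen F q j]) fun i => by
    have h0 : q ≠ 0 := IsGenericParam.ne_zero
    have h2 : q ^ 2 ≠ 1 := IsGenericParam.sq_ne_one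
    have h : rootTwist q k i = q ^ 2 ∧ rootTwist q k (!i) = (q ^ 2)⁻¹ ∨
        rootTwist q k i = (q ^ 2)⁻¹ ∧ rootTwist q k (!i) = q ^ 2 := by
      cases i <;> cases k <;> simp [rootTwist]
    rw [qSerre_lowerTriangular h0 h2 _ _ _ _ _ _ h, qSerre_gen, smul_zero]
    ext r s
    fin_cases r <;> fin_cases s <;> rfl

theorem skewMatrix_eq (k : Bool) (c : Bool → F) (w : QPos F q) :
    skewMatrix k c w = !![w, 0; skewMatrix k c w 1 0, twist k w] := by
  induction w using induction_left with
  | one => ext r s; fin_cases r <;> fin_cases s <;> simp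
  | add a b ha hb =>
    rw [map_add, ha, hb]
    ext r s; fin_cases r <;> fin_cases s <;> simp
  | smul c a ha =>
    rw [map_smul, ha]
    ext r s; fin_cases r <;> fin_cases s <;> simp
  | gen_mul i a ha =>
    rw [map_mul, ha, skewMatrix, lift_gen]
    ext r s; fin_cases r <;> fin_cases s <;> simp [Matrix.mul_apply]

/-- The skew derivation `D` with `D (a b) = D a b + K_k a D b` and given values `c` on the
generators. -/
def skewDer (k : Bool) (c : Bool → F) : QPos F q →ₗ[F] QPos F q where
  toFun w := skewMatrix k c w 1 0
  map_add' a b := by simp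
  map_smul' a b := by simp

theorem skewDer_mul (k : Bool) (c : Bool → F) (a b : QPos F q) :
    skewDer k c (a * b) = skewDer k c a * b + twist k a * skewDer k c b := by
  change skewMatrix k c (a * b) 1 0 = _
  rw [map_mul, Matrix.mul_apply, Fin.sum_univ_two]
  nth_rw 2 [skewMatrix_eq]
  nth_rw 3 [skewMatrix_eq]
  rfl

@[simp]
theorem skewDer_one (k : Bool) (c : Bool → F) : skewDer k c (1 : QPos F q) = 0 := by
  change skewMatrix k c 1 1 0 = _
  simp

@[simp]
theorem skewDer_gen (k : Bool) (c : Bool → F) (j : Bool) :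
    skewDer k c (gen F q j) = c j • 1 := by
  change skewMatrix k c _ 1 0 = _
  simp [skewMatrix]

theorem skewDer_gen_mul (k : Bool) (c : Bool → F) (j : Bool) (w : QPos F q) :
    skewDer k c (gen F q j * w) = c j • w + rootTwist q k j • (gen F q j * skewDer k c w) := by
  rw [skewDer_mul, skewDer_gen, twist_gen, smul_mul_assoc, one_mul, smul_mul_assoc]

/-- The left skew derivation dual to the generator `k`. -/
def derL (k : Bool) : QPos F q →ₗ[F] QPos F q := skewDer k (Pi.single k 1)

/-- The right skew derivation dual to the generator `k`, composed with a weight automorphism. -/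
def derR (k : Bool) : QPos F q →ₗ[F] QPos F q := skewDer (!k) (Pi.single k 1)

@[simp]
theorem derL_one (k : Bool) : derL k (1 : QPos F q) = 0 := skewDer_one _ _

@[simp]
theorem derR_one (k : Bool) : derR k (1 : QPos F q) = 0 := skewDer_one _ _

theorem derL_gen_mul (k j : Bool) (w : QPos F q) :
    derL k (gen F q j * w) =
      (Pi.single k 1 : Bool → F) j • w + rootTwist q k j • (gen F q j * derL k w) :=
  skewDer_gen_mul _ _ _ _

theorem derR_gen_mul (k j : Bool) (w : QPos F q) :
    derR k (gen F q j * w) =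
      (Pi.single k 1 : Bool → F) j • w + rootTwist q (!k) j • (gen F q j * derR k w) :=
  skewDer_gen_mul _ _ _ _

theorem derL_mul (k : Bool) (a b : QPos F q) :
    derL k (a * b) = derL k a * b + twist k a * derL k b := skewDer_mul _ _ _ _

theorem derR_mul (k : Bool) (a b : QPos F q) :
    derR k (a * b) = derR k a * b + twist (!k) a * derR k b := skewDer_mul _ _ _ _

theorem single_eq (k j : Bool) : (Pi.single k 1 : Bool → F) j = if j = k then 1 else 0 :=
  Pi.single_apply _ _ _

/-- Both `derL k` and `derR (!k)` are skew with respect to the same automorphism `twist k`, and they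
are dual to the two generators, so they span all such skew derivations. -/
theorem skewDer_eq (k : Bool) (c : Bool → F) (w : QPos F q) :
    skewDer k c w = c k • derL k w + c (!k) • derR (!k) w := by
  induction w using induction_left with
  | one => simp
  | add a b ha hb => simp only [map_add, ha, hb]; module
  | smul d a ha => simp only [map_smul, ha]; module
  | gen_mul i a ha =>
    rw [skewDer_gen_mul, derL_gen_mul, derR_gen_mul, ha, Bool.not_not, mul_add, mul_smul_comm,
      mul_smul_comm, single_eq, single_eq]
    cases i <;> cases k <;> simp <;> module

theorem derL_twist (k i : Bool) (w : QPos F q) :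
    derL k (twist i w) = rootTwist q k i • twist i (derL k w) := by
  induction w using induction_left with
  | one => simp
  | add a b ha hb => simp [ha, hb]
  | smul c a ha => simp only [map_smul, ha, smul_comm c]
  | gen_mul j a ha =>
    have := rootTwist_comm (q := q) k j
    rw [map_mul, twist_gen, smul_mul_assoc, map_smul, derL_gen_mul, ha, derL_gen_mul, map_add,
      map_smul, map_smul, map_mul, twist_gen, single_eq]
    split_ifs with h
    · subst h
      simp only [mul_smul_comm, smul_mul_assoc, rootTwist_comm i, smul_add, smul_smul,
        one_smul, mul_comm]
    · simp only [mul_smul_comm, smul_mul_assoc, rootTwist_comm i, zero_smul, zero_add,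
        smul_smul, mul_comm, mul_left_comm]

/-- Removing a letter on the left commutes with removing one on the right; the scalar appears only
because `derR` incorporates a weight automorphism. -/
theorem derL_derR (k j : Bool) (w : QPos F q) :
    derL k (derR j w) = rootTwist q k (!j) • derR j (derL k w) := by
  induction w using induction_left with
  | one => simp
  | add a b ha hb => simp [ha, hb]
  | smul c a ha => simp only [map_smul, ha, smul_comm c]
  | gen_mul i a ha =>
    simp only [derL_gen_mul, derR_gen_mul, map_add, map_smul, ha, single_eq, smul_add, smul_smul,
      mul_smul_comm]
    have h0 : q ≠ 0 := IsGenericParam.ne_zero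
    cases i <;> cases k <;> cases j <;> simp [rootTwist] <;> match_scalars <;> field_simp

/-- Only words of length one contribute to the constant term, and for these left and right
derivations agree. -/
theorem counit_derR (k : Bool) (w : QPos F q) : counit (derR k w) = counit (derL k w) := by
  induction w using induction_left with
  | one => simp
  | add a b ha hb => simp [ha, hb]
  | smul c a ha => simp [ha]
  | gen_mul i a ha => simp [derR_gen_mul, derL_gen_mul]

end SkewDer

/-! ### Rotating words of derivations. -/

section Rotation

variable [IsGenericParam q]

/-- Successive left derivations along a list of generators, the head first. -/
def derList (l : List Bool) (w : QPos F q) : QPos F q := l.foldl (fun z k => derL k z) w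

theorem derList_cons (k : Bool) (l : List Bool) (w : QPos F q) :
    derList (k :: l) w = derList l (derL k w) := rfl

theorem derList_concat (k : Bool) (l : List Bool) (w : QPos F q) :
    derList (l ++ [k]) w = derL k (derList l w) := by simp [derList]

theorem derList_smul (l : List Bool) (c : F) (w : QPos F q) :
    derList l (c • w) = c • derList l w := by
  induction l generalizing w with
  | nil => rfl
  | cons k l ih => rw [derList_cons, map_smul, ih, derList_cons]

theorem derList_derR (l : List Bool) (j : Bool) (w : QPos F q) :
    derList l (derR j w) = (l.map fun k => rootTwist q k (!j)).prod • derR j (derList l w) := by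
  induction l generalizing w with
  | nil => simp [derList]
  | cons k l ih =>
    rw [derList_cons, derL_derR, derList_smul, ih, derList_cons, smul_smul, List.map_cons,
      List.prod_cons]

/-- The first derivation is traded for a right one, moved past the others, and turned back into a
left one once only the constant term matters. -/
theorem counit_derList_rotate {v : QPos F q}
    (hv : ∀ i, derL i v = (q ^ 2)⁻¹ • derR (!i) v) (i : Bool) (l : List Bool) :
    counit (derList (i :: l) v) =
      ((q ^ 2)⁻¹ * (l.map fun k => rootTwist q k i).prod) * counit (derList (l ++ [!i]) v) := by
  rw [derList_cons, hv, derList_smul, derList_derR, derList_concat, map_smul, map_smul,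
    counit_derR, Bool.not_not, smul_eq_mul, smul_eq_mul, mul_assoc]

/-- Rotating the list `l` past `m` and negating its entries. -/
theorem counit_derList_rotate_list {v : QPos F q}
    (hv : ∀ i, derL i v = (q ^ 2)⁻¹ • derR (!i) v) (l m : List Bool) :
    counit (derList (l ++ m) v) =
      (((q ^ 2)⁻¹) ^ l.length * (l.map fun i => (m.map fun k => rootTwist q k i).prod).prod) *
        counit (derList (m ++ l.map (!·)) v) := by
  induction l generalizing m with
  | nil => simp
  | cons i l ih =>
    -- The twists between entries of `l` itself cancel, since `!i` and `i` have inverse twists; only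
    -- those between `l` and `m` survive.
    have h1 : (l.map fun k => rootTwist q k i).prod * (l.map fun j => rootTwist q (!i) j).prod
        = 1 := by
      rw [← List.prod_map_mul]
      apply List.prod_eq_one
      intro x hx
      obtain ⟨k, -, rfl⟩ := List.mem_map.1 hx
      rw [rootTwist_comm, rootTwist_mul_not]
    rw [List.cons_append, counit_derList_rotate hv, List.append_assoc, ih]
    simp only [List.map_append, List.prod_append, List.map_cons, List.map_nil, List.prod_cons,
      List.prod_nil, mul_one, List.length_cons, pow_succ, List.append_assoc, List.cons_append,
      List.nil_append, List.prod_map_mul]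
    linear_combination ((q ^ 2)⁻¹ ^ l.length * (q ^ 2)⁻¹ * (m.map fun k => rootTwist q k i).prod *
      (l.map fun j => (m.map fun k => rootTwist q k j).prod).prod *
      counit (derList (m ++ (!i) :: l.map (!·)) v)) * h1

/-- Rotating the whole word negates its letters, and doing so twice restores it with factor `q ^ (-4
* l.length)`, which is not `1`. -/
theorem counit_derList_eq_zero {v : QPos F q}
    (hv : ∀ i, derL i v = (q ^ 2)⁻¹ • derR (!i) v) (l : List Bool) (hl : l ≠ []) :
    counit (derList l v) = 0 := by
  have h1 := counit_derList_rotate_list hv l []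
  have h2 := counit_derList_rotate_list hv (l.map (!·)) []
  simp only [List.append_nil, List.nil_append, List.map_nil, List.prod_nil, List.length_map,
    List.map_const', List.prod_replicate, one_pow, mul_one, List.map_map] at h1 h2
  have e : ((fun i => !i) ∘ fun i => !i) = (id : Bool → Bool) := by ext; simp
  have e' : ((fun _ : Bool => (1 : F)) ∘ fun x => !x) = fun _ => 1 := rfl
  rw [e, List.map_id, e', List.map_const', List.prod_replicate, one_pow, mul_one] at h2
  rw [h2, ← mul_assoc] at h1
  by_contra h
  have h3 : (q ^ 2)⁻¹ ^ l.length * (q ^ 2)⁻¹ ^ l.length = 1 := by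
    apply mul_right_cancel₀ h
    rw [← h1, one_mul]
  rw [inv_pow, ← mul_inv, inv_eq_one, ← pow_mul, ← pow_add] at h3
  have := List.length_pos_iff.2 hl
  exact IsGenericParam.pow_ne_one _ (by omega) h3

end Rotation


/-! ### Length filtration and contraction of tensors. -/

open TensorProduct

variable {F : Type u} [Field F] {q : F}

/-- Elements that are combinations of words of length less than `n`. -/
inductive LengthLT : ℕ → QPos F q → Prop
  | zero (n : ℕ) : LengthLT n 0
  | one (n : ℕ) : LengthLT (n + 1) 1
  | add {n : ℕ} {a b : QPos F q} : LengthLT n a → LengthLT n b → LengthLT n (a + b)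
  | smul {n : ℕ} (c : F) {a : QPos F q} : LengthLT n a → LengthLT n (c • a)
  | gen_mul {n : ℕ} (i : Bool) {a : QPos F q} : LengthLT n a → LengthLT (n + 1) (gen F q i * a)

theorem LengthLT.eq_zero {w : QPos F q} (h : LengthLT 0 w) : w = 0 := by
  generalize hn : 0 = n at h
  induction h with
  | zero => rfl
  | one n => omega
  | add _ _ ha hb => rw [ha hn, hb hn, add_zero]
  | smul c _ ha => rw [ha hn, smul_zero]
  | gen_mul => omega

theorem LengthLT.mono {m n : ℕ} {w : QPos F q} (h : LengthLT m w) (hmn : m ≤ n) :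
    LengthLT n w := by
  induction h generalizing n with
  | zero => exact .zero _
  | one m => obtain ⟨n, rfl⟩ : ∃ k, n = k + 1 := ⟨n - 1, by omega⟩; exact .one _
  | add _ _ ha hb => exact (ha hmn).add (hb hmn)
  | smul c _ ha => exact (ha hmn).smul c
  | gen_mul i _ ha =>
    obtain ⟨n, rfl⟩ : ∃ k, n = k + 1 := ⟨n - 1, by omega⟩
    exact (ha (by omega)).gen_mul i

theorem exists_lengthLT (w : QPos F q) : ∃ n, LengthLT n w := by
  induction w using induction_left with
  | one => exact ⟨1, .one 0⟩
  | add a b ha hb =>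
    obtain ⟨m, hm⟩ := ha
    obtain ⟨n, hn⟩ := hb
    exact ⟨m + n, (hm.mono (by omega)).add (hn.mono (by omega))⟩
  | smul c a ha => obtain ⟨m, hm⟩ := ha; exact ⟨m, hm.smul c⟩
  | gen_mul i a ha => obtain ⟨m, hm⟩ := ha; exact ⟨m + 1, hm.gen_mul i⟩

/-- Multiplication by a generator raises the length by one, also with truncated subtraction. -/
theorem LengthLT.gen_mul_pred {n : ℕ} (i : Bool) {a b : QPos F q} (ha : LengthLT n a)
    (hb : LengthLT (n - 1) b) (hab : a = 0 → b = 0) : LengthLT n (gen F q i * b) := by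
  cases n with
  | zero => rw [hab ha.eq_zero, mul_zero]; exact .zero _
  | succ n => exact hb.gen_mul i

theorem LengthLT.twist {n : ℕ} (k : Bool) {a : QPos F q} (ha : LengthLT n a) :
    LengthLT n (twist k a) := by
  induction ha with
  | zero => rw [map_zero]; exact .zero _
  | one => rw [map_one]; exact .one _
  | add _ _ ha hb => rw [map_add]; exact ha.add hb
  | smul c _ ha => rw [map_smul]; exact ha.smul c
  | gen_mul i _ ha =>
    rw [map_mul, twist_gen, smul_mul_assoc]; exact (ha.gen_mul i).smul _

/-- Applying a functional to the second tensor factor. -/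
def contract (φ : QPos F q →ₗ[F] F) : QPos F q ⊗[F] QPos F q →ₗ[F] QPos F q :=
  (TensorProduct.rid F (QPos F q)).toLinearMap ∘ₗ φ.lTensor (QPos F q)

@[simp]
theorem contract_tmul (φ : QPos F q →ₗ[F] F) (a b : QPos F q) :
    contract φ (a ⊗ₜ b) = φ b • a := by simp [contract]

theorem eq_zero_of_contract (z : QPos F q ⊗[F] QPos F q) (h : ∀ φ, contract φ z = 0) : z = 0 := by
  classical
  let b := Module.Basis.ofVectorSpace F (QPos F q)
  apply (TensorProduct.equivFinsuppOfBasisRight (M := QPos F q) b).injective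
  ext i
  rw [map_zero, Finsupp.zero_apply, ← h (b.coord i)]
  clear h
  induction z using TensorProduct.induction_on with
  | zero => simp
  | add x y hx hy => rw [map_add, map_add, Finsupp.add_apply, hx, hy]
  | tmul x y => simp

theorem contract_map_mulLeft_left (φ : QPos F q →ₗ[F] F) (a : QPos F q) (z) :
    contract φ (TensorProduct.map (LinearMap.mulLeft F a) LinearMap.id z) = a * contract φ z := by
  induction z using TensorProduct.induction_on with
  | zero => simp
  | add x y hx hy => simp only [map_add, hx, hy, mul_add]
  | tmul x y => simp

theorem contract_map_twist (φ : QPos F q →ₗ[F] F) (i : Bool) (a : QPos F q) (z) :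
    contract φ (TensorProduct.map (twist i).toLinearMap (LinearMap.mulLeft F a) z) =
      twist i (contract (φ ∘ₗ LinearMap.mulLeft F a) z) := by
  induction z using TensorProduct.induction_on with
  | zero => simp
  | add x y hx hy => simp only [map_add, hx, hy]
  | tmul x y => simp

/-! ### The braided coproduct and primitive elements. -/

section Coproduct

variable [IsGenericParam q]

theorem LengthLT.skewDer {n : ℕ} (k : Bool) (c : Bool → F) {a : QPos F q} (ha : LengthLT n a) :
    LengthLT (n - 1) (skewDer k c a) := by
  induction ha with
  | zero => rw [map_zero]; exact .zero _
  | one => rw [skewDer_one]; exact .zero _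
  | add _ _ ha hb => rw [map_add]; exact ha.add hb
  | smul c _ ha => rw [map_smul]; exact ha.smul c
  | gen_mul i h ha =>
    rw [skewDer_gen_mul]
    exact (h.smul _).add ((h.gen_mul_pred i ha (by rintro rfl; simp)).smul _)

/-- The algebra map behind the braided coproduct. -/
def coproductAlgHom : QPos F q →ₐ[F] Module.End F (QPos F q) ⊗[F] QPos F q :=
  lift (R := Module.End F (QPos F q) ⊗[F] QPos F q)
    (fun i => LinearMap.mulLeft F (gen F q i) ⊗ₜ 1 + (twist i).toLinearMap ⊗ₜ gen F q i)
    fun i => by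
      have h0 : q ≠ 0 := IsGenericParam.ne_zero
      have h2 : q ^ 2 ≠ 1 := IsGenericParam.sq_ne_one
      have hK : ∀ k j : Bool, ((twist k).toLinearMap : Module.End F (QPos F q)) *
          LinearMap.mulLeft F (gen F q j) =
          rootTwist q k j • (LinearMap.mulLeft F (gen F q j) * (twist k).toLinearMap) := by
        intro k j; ext w; simp
      have hKK : ((twist i).toLinearMap : Module.End F (QPos F q)) * (twist (!i)).toLinearMap =
          (twist (!i)).toLinearMap * (twist i).toLinearMap := by
        ext w; simp [twist_comm i]
      -- With endomorphisms in the first factor, the operators `twist i` carry the braiding: moving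
      -- them past left multiplications yields exactly the required scalars.
      apply qSerre_add h0 h2
      · rw [Algebra.TensorProduct.tmul_mul_tmul, Algebra.TensorProduct.tmul_mul_tmul, hK,
          rootTwist_self, smul_tmul', mul_one, one_mul]
      · rw [Algebra.TensorProduct.tmul_mul_tmul, Algebra.TensorProduct.tmul_mul_tmul, hK,
          rootTwist_not, smul_tmul', mul_one, one_mul]
      · rw [Algebra.TensorProduct.tmul_mul_tmul, Algebra.TensorProduct.tmul_mul_tmul, hK,
          rootTwist_not', smul_tmul', mul_one, one_mul]
      · have e : qSerre q (LinearMap.mulLeft F (gen F q i)) (LinearMap.mulLeft F (gen F q (!i))) =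
            (0 : Module.End F (QPos F q)) := by
          have := map_qSerre (q := q) (Algebra.lmul F (QPos F q)) (gen F q i) (gen F q (!i))
          rw [qSerre_gen, map_zero] at this
          exact this.symm
        rw [← zero_tmul (Module.End F (QPos F q)) (1 : QPos F q), ← e]
        simp only [qSerre, pow_succ, pow_zero, one_mul, Algebra.TensorProduct.tmul_mul_tmul,
          sub_tmul, add_tmul, mul_one, ← smul_tmul']
      · have e : qSerre q ((twist i).toLinearMap ⊗ₜ gen F q i)
          ((twist (!i)).toLinearMap ⊗ₜ[F] gen F q (!i)) =
          ((((twist i).toLinearMap : Module.End F (QPos F q)) ^ 3 * (twist (!i)).toLinearMap)) ⊗ₜ[F]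
            qSerre q (gen F q i) (gen F q (!i)) := by
          generalize ((twist i).toLinearMap : Module.End F (QPos F q)) = K,
            ((twist (!i)).toLinearMap : Module.End F (QPos F q)) = K' at hKK
          have hKK' : ∀ z, K' * (K * z) = K * (K' * z) := fun z => by
            rw [← mul_assoc, ← hKK, mul_assoc]
          simp only [qSerre, pow_succ, pow_zero, one_mul, Algebra.TensorProduct.tmul_mul_tmul,
            tmul_sub, tmul_add, mul_assoc, hKK', ← hKK, ← tmul_smul]
        rw [e, qSerre_gen, tmul_zero]

/-- The braided coproduct. -/
def coproduct : QPos F q →ₗ[F] QPos F q ⊗[F] QPos F q :=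
  (LinearMap.applyₗ (1 : QPos F q)).rTensor (QPos F q) ∘ₗ coproductAlgHom.toLinearMap

theorem coproduct_one : coproduct (1 : QPos F q) = 1 ⊗ₜ 1 := by
  simp [coproduct, Algebra.TensorProduct.one_def]

theorem coproduct_gen_mul (i : Bool) (w : QPos F q) :
    coproduct (gen F q i * w) =
      TensorProduct.map (LinearMap.mulLeft F (gen F q i)) LinearMap.id (coproduct w) +
      TensorProduct.map (twist i).toLinearMap (LinearMap.mulLeft F (gen F q i)) (coproduct w) := by
  simp only [coproduct, LinearMap.comp_apply, AlgHom.toLinearMap_apply, map_mul]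
  rw [coproductAlgHom, lift_gen, ← coproductAlgHom]
  induction coproductAlgHom w using TensorProduct.induction_on with
  | zero => simp
  | add x y hx hy => simp only [mul_add, map_add, hx, hy]; abel
  | tmul x y => simp [add_mul, Algebra.TensorProduct.tmul_mul_tmul]

/-- A left derivation sees only the first tensor factor. Hence contractions of the coproduct of an
element of the common kernel stay in the common kernel. -/
theorem rTensor_derL_coproduct (k : Bool) (w : QPos F q) :
    (derL k).rTensor (QPos F q) (coproduct w) = coproduct (derL k w) := by
  induction w using induction_left with
  | one => simp [coproduct_one]
  | add a b ha hb => simp [ha, hb]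
  | smul c a ha => simp [ha]
  | gen_mul i a ha =>
    rw [derL_gen_mul, coproduct_gen_mul, map_add (coproduct), map_smul, map_smul,
      coproduct_gen_mul, ← ha]
    induction coproduct a using TensorProduct.induction_on with
    | zero => simp
    | add x y hx hy =>
      simp only [map_add, smul_add] at hx hy ⊢
      rw [add_add_add_comm, hx, hy]
      abel
    | tmul x y =>
      simp only [map_tmul, map_add, LinearMap.rTensor_tmul, LinearMap.mulLeft_apply,
        LinearMap.id_apply, AlgHom.toLinearMap_apply, derL_gen_mul, derL_twist, add_tmul,
        smul_tmul', smul_add]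
      abel

theorem derL_contract (φ : QPos F q →ₗ[F] F) (k : Bool) (z) :
    derL k (contract φ z) = contract φ ((derL k).rTensor (QPos F q) z) := by
  induction z using TensorProduct.induction_on with
  | zero => simp
  | add x y hx hy => simp only [map_add, hx, hy]
  | tmul x y => simp

theorem counit_contract_coproduct (φ : QPos F q →ₗ[F] F) (w : QPos F q) :
    counit (contract φ (coproduct w)) = φ w := by
  induction w using induction_left generalizing φ with
  | one => simp [coproduct_one]
  | add a b ha hb => simp [ha, hb]
  | smul c a ha => simp [ha]
  | gen_mul i a ha =>
    rw [coproduct_gen_mul, map_add, contract_map_mulLeft_left, contract_map_twist, map_add,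
      map_mul, counit_gen, zero_mul, zero_add]
    have : ∀ w : QPos F q, counit (twist i w) = counit w := by
      intro w
      induction w using induction_left with
      | one => simp
      | add a b ha hb => simp [ha, hb]
      | smul c a ha => simp [ha]
      | gen_mul i a ha => simp
    rw [this, ha]
    rfl

/-- Apart from `w ⊗ 1`, every term in the coproduct of `w` has a shorter first factor. This drop in
length drives the induction that yields primitivity. -/
theorem LengthLT.contract_coproduct {n : ℕ} {w : QPos F q} (hw : LengthLT n w)
    (φ : QPos F q →ₗ[F] F) : LengthLT (n - 1) (contract φ (coproduct w) - φ 1 • w) := by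
  induction hw generalizing φ with
  | zero => simpa using .zero _
  | one => simpa [coproduct_one] using .zero _
  | @add n a b _ _ ha hb =>
    have : contract φ (coproduct (a + b)) - φ 1 • (a + b) =
      (contract φ (coproduct a) - φ 1 • a) + (contract φ (coproduct b) - φ 1 • b) := by
      simp only [map_add, smul_add]; abel
    rw [this]; exact (ha φ).add (hb φ)
  | @smul n c a _ ha =>
    have : contract φ (coproduct (c • a)) - φ 1 • (c • a) =
      c • (contract φ (coproduct a) - φ 1 • a) := by
      simp only [map_smul, smul_sub, smul_comm c]
    rw [this]; exact (ha φ).smul c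
  | @gen_mul n i a h ha =>
    set φ' := φ ∘ₗ LinearMap.mulLeft F (gen F q i)
    have : contract φ (coproduct (gen F q i * a)) - φ 1 • (gen F q i * a) =
        gen F q i * (contract φ (coproduct a) - φ 1 • a) +
        QPos.twist i ((contract φ' (coproduct a) - φ' 1 • a) + φ' 1 • a) := by
      rw [coproduct_gen_mul, map_add, contract_map_mulLeft_left, contract_map_twist,
        sub_add_cancel, mul_sub, mul_smul_comm]
      abel
    rw [this]
    refine .add (h.gen_mul_pred i (ha φ) (by rintro rfl; simp))
      (.twist i (LengthLT.add ?_ (h.smul _)))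
    exact (ha φ').mono (by omega)

/-- If the left derivations have only scalars as common kernel in shorter lengths, then the
elements they annihilate are primitive. -/
theorem coproduct_eq_of_derL_eq_zero {n : ℕ}
    (ih : ∀ w : QPos F q, LengthLT n w → (∀ k, derL k w = 0) → w = counit w • 1)
    {v : QPos F q} (hn : LengthLT (n + 1) v) (hv : ∀ k, derL k v = 0) (h0 : counit v = 0) :
    coproduct v = v ⊗ₜ 1 + 1 ⊗ₜ v := by
  rw [← sub_eq_zero]
  apply eq_zero_of_contract
  intro φ
  -- The contraction minus `φ 1 • v` is shorter and is killed by the left derivations, so it is a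
  -- scalar, and the counit identifies this scalar as `φ v`.
  have h1 := ih _ (hn.contract_coproduct φ) fun k => by
    rw [map_sub, map_smul, derL_contract, rTensor_derL_coproduct, hv, map_zero, map_zero,
      smul_zero, sub_zero]
  rw [map_sub, map_smul, counit_contract_coproduct, h0, smul_zero, sub_zero] at h1
  rw [map_sub, map_add, contract_tmul, contract_tmul, ← h1]
  abel

end Coproduct

/-! ### The braided antipode. -/

section Antipode

/-- Right multiplication by a generator, composed with minus the weight automorphism. -/
def antipodeOp (i : Bool) : Module.End F (QPos F q) :=
  -(LinearMap.mulRight F (gen F q i) * (twist i).toLinearMap)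

theorem antipodeOp_apply (i : Bool) (w : QPos F q) :
    antipodeOp i w = -(twist i w * gen F q i) := rfl

variable [IsGenericParam q]

/-- The braided antipode, as the orbit map of a representation. -/
def antipodeAlgHom : QPos F q →ₐ[F] Module.End F (QPos F q) :=
  lift antipodeOp fun i => by
    ext w
    have hs := qSerre_gen (F := F) (q := q) i
    have h0 : q ≠ 0 := IsGenericParam.ne_zero
    -- Composing right multiplications reverses words, and reversal negates the Serre expression.
    -- The twists contribute the same scalar to every ordering, namely `q ^ 6 * q ^ (-6) = 1`.
    have : qSerre q (antipodeOp i) (antipodeOp (!i)) w =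
        -((twist i (twist i (twist i (twist (!i) w)))) * qSerre q (gen F q i) (gen F q (!i))) := by
      have hc : ∀ w : QPos F q, twist (!i) (twist i w) = twist i (twist (!i) w) :=
        fun w => twist_comm _ _ _
      simp only [qSerre, pow_succ, pow_zero, one_mul, LinearMap.sub_apply, LinearMap.add_apply,
        LinearMap.smul_apply, Module.End.mul_apply, antipodeOp_apply, map_neg, map_mul, twist_gen,
        map_smul, hc, rootTwist_self, rootTwist_not, rootTwist_not', neg_neg,
        smul_mul_assoc, mul_smul_comm, smul_smul, mul_assoc, mul_add, mul_sub]
      match_scalars <;> field_simp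
    rw [this, hs, mul_zero, neg_zero]
    rfl

/-- The braided antipode. -/
def antipode : QPos F q →ₗ[F] QPos F q :=
  LinearMap.applyₗ (1 : QPos F q) ∘ₗ antipodeAlgHom.toLinearMap

@[simp]
theorem antipode_one : antipode (1 : QPos F q) = 1 := by simp [antipode]

theorem antipode_gen_mul (i : Bool) (w : QPos F q) :
    antipode (gen F q i * w) = -(twist i (antipode w) * gen F q i) := by
  simp [antipode, antipodeAlgHom, antipodeOp_apply]

theorem antipode_twist (k : Bool) (w : QPos F q) :
    antipode (twist k w) = twist k (antipode w) := by
  induction w using induction_left with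
  | one => simp
  | add a b ha hb => simp [ha, hb]
  | smul c a ha => simp [ha]
  | gen_mul i a ha =>
    rw [map_mul, twist_gen, smul_mul_assoc, map_smul, antipode_gen_mul, antipode_gen_mul, ha,
      map_neg, map_mul, twist_gen, twist_comm, mul_smul_comm, smul_neg]

theorem antipode_mul_gen (i : Bool) (w : QPos F q) :
    antipode (w * gen F q i) = -(gen F q i * twist i (antipode w)) := by
  induction w using induction_left with
  | one =>
    have := antipode_gen_mul (F := F) (q := q) i 1
    simpa using this
  | add a b ha hb => simp only [add_mul, map_add, ha, hb, mul_add, neg_add]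
  | smul c a ha => simp [ha]
  | gen_mul j a ha =>
    rw [mul_assoc, antipode_gen_mul, ha, antipode_gen_mul]
    simp only [map_neg, map_mul, twist_gen, smul_mul_assoc, mul_smul_comm, neg_mul, mul_neg,
      mul_assoc, rootTwist_comm i j, twist_comm i j]

theorem antipode_antipode_gen_mul (i : Bool) (w : QPos F q) :
    antipode (antipode (gen F q i * w)) =
      gen F q i * twist i (twist i (antipode (antipode w))) := by
  rw [antipode_gen_mul, map_neg, antipode_mul_gen, antipode_twist, neg_neg]

/-- The antipode identity. -/
theorem mul_antipode_coproduct (w : QPos F q) :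
    LinearMap.mul' F (QPos F q) (antipode.lTensor (QPos F q) (coproduct w)) = counit w • 1 := by
  induction w using induction_left with
  | one => simp [coproduct_one]
  | add a b ha hb => simp [ha, hb, add_smul]
  | smul c a ha => simp [ha, mul_smul]
  | gen_mul i a ha =>
    have : ∀ z : QPos F q ⊗[F] QPos F q, LinearMap.mul' F (QPos F q) (antipode.lTensor (QPos F q)
        (TensorProduct.map (LinearMap.mulLeft F (gen F q i)) LinearMap.id z +
          TensorProduct.map (twist i).toLinearMap (LinearMap.mulLeft F (gen F q i)) z)) =
        gen F q i * LinearMap.mul' F (QPos F q) (antipode.lTensor (QPos F q) z) -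
        twist i (LinearMap.mul' F (QPos F q) (antipode.lTensor (QPos F q) z)) * gen F q i := by
      intro z
      induction z using TensorProduct.induction_on with
      | zero => simp
      | add x y hx hy =>
        simp only [map_add, mul_add, add_mul] at hx hy ⊢
        rw [add_add_add_comm, hx, hy]
        abel
      | tmul x y => simp [antipode_gen_mul, mul_assoc, sub_eq_add_neg]
    rw [coproduct_gen_mul, this, ha]
    simp

theorem antipode_eq_neg {v : QPos F q} (hv : coproduct v = v ⊗ₜ 1 + 1 ⊗ₜ v)
    (h0 : counit v = 0) : antipode v = -v := by
  have := mul_antipode_coproduct v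
  rw [hv, h0] at this
  simp only [map_add, LinearMap.lTensor_tmul, LinearMap.mul'_apply, antipode_one, mul_one,
    one_mul, zero_smul] at this
  exact eq_neg_of_add_eq_zero_right this

end Antipode


variable {F : Type u} [Field F] {q : F}

/-! ### The multigrading, and the squared antipode on each degree. -/

section Grading

/-- The simple root attached to a generator. -/
abbrev simpleRoot (i : Bool) : Bool → ℤ := Pi.single i 1

/-- The coaction that records the multidegree. -/
noncomputable def degreeAlgHom : QPos F q →ₐ[F] AddMonoidAlgebra (QPos F q) (Bool → ℤ) :=
  lift (fun i => AddMonoidAlgebra.single (simpleRoot i) (gen F q i)) fun i => by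
    have e : qSerre q (AddMonoidAlgebra.single (simpleRoot i) (gen F q i))
        (AddMonoidAlgebra.single (simpleRoot (!i)) (gen F q (!i))) =
        AddMonoidAlgebra.single (simpleRoot i + simpleRoot i + simpleRoot i + simpleRoot (!i))
          (qSerre q (gen F q i) (gen F q (!i))) := by
      have h1 : simpleRoot i + simpleRoot i + simpleRoot (!i) + simpleRoot i =
        simpleRoot i + simpleRoot i + simpleRoot i + simpleRoot (!i) := by abel
      have h2 : simpleRoot i + simpleRoot (!i) + (simpleRoot i + simpleRoot i) =
        simpleRoot i + simpleRoot i + simpleRoot i + simpleRoot (!i) := by abel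
      have h3 : simpleRoot (!i) + (simpleRoot i + simpleRoot i + simpleRoot i) =
        simpleRoot i + simpleRoot i + simpleRoot i + simpleRoot (!i) := by abel
      simp only [qSerre, pow_succ, pow_zero, one_mul, AddMonoidAlgebra.single_mul_single,
        AddMonoidAlgebra.single_add, AddMonoidAlgebra.single_sub, ← AddMonoidAlgebra.smul_single,
        h1, h2, h3]
    rw [e, qSerre_gen, AddMonoidAlgebra.single_zero]

/-- The projection to a homogeneous component. -/
noncomputable def proj (γ : Bool → ℤ) : QPos F q →ₗ[F] QPos F q where
  toFun w := (degreeAlgHom w).coeff γ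
  map_add' a b := by simp
  map_smul' a b := by simp

theorem proj_gen_mul (γ : Bool → ℤ) (i : Bool) (w : QPos F q) :
    proj γ (gen F q i * w) = gen F q i * proj (γ - simpleRoot i) w := by
  change (degreeAlgHom _).coeff γ = _
  rw [map_mul, degreeAlgHom, lift_gen, AddMonoidAlgebra.coeff_single_mul_apply, neg_add_eq_sub]
  rfl

theorem proj_mul_gen (γ : Bool → ℤ) (i : Bool) (w : QPos F q) :
    proj γ (w * gen F q i) = proj (γ - simpleRoot i) w * gen F q i := by
  change (degreeAlgHom _).coeff γ = _
  rw [map_mul, degreeAlgHom, lift_gen, AddMonoidAlgebra.coeff_mul_single_apply, ← sub_eq_add_neg]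
  rfl

theorem proj_one (γ : Bool → ℤ) : proj γ (1 : QPos F q) = if γ = 0 then 1 else 0 := by
  change (degreeAlgHom _).coeff γ = _
  rw [map_one, AddMonoidAlgebra.one_def, AddMonoidAlgebra.coeff_single, Finsupp.single_apply]
  simp only [eq_comm]

theorem proj_proj (γ : Bool → ℤ) (w : QPos F q) : proj γ (proj γ w) = proj γ w := by
  induction w using induction_left generalizing γ with
  | one => rw [proj_one]; split_ifs with h <;> simp [proj_one, h]
  | add a b ha hb => simp [ha, hb]
  | smul c a ha => simp [ha]
  | gen_mul i a ha => rw [proj_gen_mul, proj_gen_mul, ha]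

theorem proj_eq_zero {γ : Bool → ℤ} (j : Bool) (hγ : γ j < 0) (w : QPos F q) : proj γ w = 0 := by
  induction w using induction_left generalizing γ with
  | one => rw [proj_one, if_neg]; rintro rfl; simp at hγ
  | add a b ha hb => simp [ha hγ, hb hγ]
  | smul c a ha => simp [ha hγ]
  | gen_mul i a ha =>
    rw [proj_gen_mul, ha, mul_zero]
    have : (0 : ℤ) ≤ simpleRoot i j := by
      rw [simpleRoot, Pi.single_apply]; split_ifs <;> simp
    rw [Pi.sub_apply]; omega

theorem proj_zero (w : QPos F q) : proj 0 w = counit w • 1 := by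
  induction w using induction_left with
  | one => simp [proj_one]
  | add a b ha hb => simp [ha, hb, add_smul]
  | smul c a ha => simp [ha, mul_smul]
  | gen_mul i a ha => rw [proj_gen_mul, proj_eq_zero i (by simp)]; simp

/-- Forgetting the multidegree. -/
noncomputable def forgetDegree : AddMonoidAlgebra (QPos F q) (Bool → ℤ) →+* QPos F q :=
  AddMonoidAlgebra.liftNCRingHom (RingHom.id _) 1 fun _ _ => Commute.one_right _

theorem forgetDegree_single (γ : Bool → ℤ) (a : QPos F q) :
    forgetDegree (AddMonoidAlgebra.single γ a) = a :=
  (AddMonoidAlgebra.liftNC_single _ _ _ _).trans (mul_one a)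

theorem forgetDegree_degreeAlgHom (w : QPos F q) : forgetDegree (degreeAlgHom w) = w := by
  induction w using induction_left with
  | one => simp
  | add a b ha hb => simp [ha, hb]
  | smul c a ha =>
    rw [Algebra.smul_def, map_mul, map_mul, ha, AlgHom.commutes, AddMonoidAlgebra.coe_algebraMap,
      Function.comp_apply, forgetDegree_single]
  | gen_mul i a ha => rw [map_mul, map_mul, ha, degreeAlgHom, lift_gen, forgetDegree_single]

/-- An element whose components of nonzero degree vanish is a scalar. -/
theorem eq_counit_of_proj_eq_zero (w : QPos F q) (h : ∀ γ, γ ≠ 0 → proj γ w = 0) :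
    w = counit w • 1 := by
  have h1 : degreeAlgHom w = AddMonoidAlgebra.single 0 (proj 0 w) := by
    ext γ
    rw [AddMonoidAlgebra.coeff_single, Finsupp.single_apply]
    split_ifs with h0
    · rw [← h0]; rfl
    · exact h γ (Ne.symm h0)
  rw [← proj_zero, ← forgetDegree_single 0 (proj 0 w), ← h1, forgetDegree_degreeAlgHom]

theorem proj_twist (γ : Bool → ℤ) (k : Bool) (w : QPos F q) :
    proj γ (twist k w) = twist k (proj γ w) := by
  induction w using induction_left generalizing γ with
  | one => rw [map_one, proj_one]; split_ifs <;> simp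
  | add a b ha hb => simp [ha, hb]
  | smul c a ha => simp [ha]
  | gen_mul i a ha => simp [proj_gen_mul, ha]

theorem rootTwist_eq_zpow (k i : Bool) :
    rootTwist q k i = (q ^ 2) ^ (simpleRoot i k - simpleRoot i (!k)) := by
  cases k <;> cases i <;> simp [rootTwist]

variable [IsGenericParam q]

theorem twist_proj (k : Bool) (γ : Bool → ℤ) (w : QPos F q) :
    twist k (proj γ w) = (q ^ 2) ^ (γ k - γ (!k)) • proj γ w := by
  induction w using induction_left generalizing γ with
  | one => rw [proj_one]; split_ifs with h <;> simp [h]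
  | add a b ha hb => simp [ha, hb]
  | smul c a ha => simp [ha, smul_comm c]
  | gen_mul i a ha =>
    rw [proj_gen_mul, map_mul, ha, twist_gen, smul_mul_assoc, mul_smul_comm, smul_smul,
      rootTwist_eq_zpow, ← zpow_add₀ sq_ne_zero']
    congr 2
    simp only [Pi.sub_apply]
    ring

theorem proj_antipode (γ : Bool → ℤ) (w : QPos F q) :
    proj γ (antipode w) = antipode (proj γ w) := by
  induction w using induction_left generalizing γ with
  | one => rw [antipode_one, proj_one]; split_ifs <;> simp
  | add a b ha hb => simp [ha, hb]
  | smul c a ha => simp [ha]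
  | gen_mul i a ha =>
    rw [antipode_gen_mul, map_neg, proj_mul_gen, proj_twist, ha, proj_gen_mul, antipode_gen_mul]

/-- Each further generator `i` adds the exponent of `twist i` applied twice, namely `2 * (γ i - 1 -
γ (!i))`; this is the increment of the displayed quadratic function. -/
theorem antipode_antipode_proj (γ : Bool → ℤ) (w : QPos F q) :
    antipode (antipode (proj γ w)) =
      (q ^ 2) ^ ((γ false - γ true) ^ 2 - (γ false + γ true)) • proj γ w := by
  induction w using induction_left generalizing γ with
  | one => rw [proj_one]; split_ifs with h <;> simp [h]
  | add a b ha hb => simp [ha, hb]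
  | smul c a ha => simp [ha, smul_comm c]
  | gen_mul i a ha =>
    rw [proj_gen_mul, antipode_antipode_gen_mul, ha, map_smul, map_smul, twist_proj, map_smul,
      twist_proj, smul_smul, smul_smul, mul_smul_comm, ← zpow_add₀ sq_ne_zero',
      ← zpow_add₀ sq_ne_zero']
    congr 2
    cases i <;> simp <;> ring

theorem derL_proj (k : Bool) (γ : Bool → ℤ) (w : QPos F q) :
    derL k (proj γ w) = proj (γ - simpleRoot k) (derL k w) := by
  induction w using induction_left generalizing γ with
  | one => rw [proj_one]; split_ifs <;> simp
  | add a b ha hb => simp [ha, hb]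
  | smul c a ha => simp [ha]
  | gen_mul i a ha =>
    rw [proj_gen_mul, derL_gen_mul, ha, derL_gen_mul, map_add, map_smul, map_smul, proj_gen_mul,
      sub_right_comm, single_eq]
    split_ifs with h
    · rw [h]
    · simp

theorem derR_proj (k : Bool) (γ : Bool → ℤ) (w : QPos F q) :
    derR k (proj γ w) = proj (γ - simpleRoot k) (derR k w) := by
  induction w using induction_left generalizing γ with
  | one => rw [proj_one]; split_ifs <;> simp
  | add a b ha hb => simp [ha, hb]
  | smul c a ha => simp [ha]
  | gen_mul i a ha =>
    rw [proj_gen_mul, derR_gen_mul, ha, derR_gen_mul, map_add, map_smul, map_smul, proj_gen_mul,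
      sub_right_comm, single_eq]
    split_ifs with h
    · rw [h]
    · simp

end Grading


variable {F : Type u} [Field F] {q : F}

/-! ### Root strings and lowest weight vectors for one generator. -/

section Sl2

/-- The iterated `q`-commutators of the generator `k` with the other one. -/
def rootVector (F : Type u) [Field F] (q : F) (k : Bool) : Fin 3 → QPos F q
  | 0 => gen F q (!k)
  | 1 => gen F q k * gen F q (!k) - q ^ 2 • (gen F q (!k) * gen F q k)
  | 2 => gen F q k * (gen F q k * gen F q (!k) - q ^ 2 • (gen F q (!k) * gen F q k)) -
      (gen F q k * gen F q (!k) - q ^ 2 • (gen F q (!k) * gen F q k)) * gen F q k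

/-- Combinations of products of a power of the generator `k` and of root vectors, of degree `m` in
the generator `k` and of degree `n` in the other one. -/
inductive RootSpan (k : Bool) : ℤ → ℤ → QPos F q → Prop
  | zero (m n : ℤ) : RootSpan k m n 0
  | add {m n : ℤ} {a b : QPos F q} : RootSpan k m n a → RootSpan k m n b → RootSpan k m n (a + b)
  | smul {m n : ℤ} (c : F) {a : QPos F q} : RootSpan k m n a → RootSpan k m n (c • a)
  | pow (a : ℕ) : RootSpan k a 0 (gen F q k ^ a)
  | mul_root {m n : ℤ} (j : Fin 3) {a : QPos F q} :
      RootSpan k m n a → RootSpan k (m + (j : ℕ)) (n + 1) (a * rootVector F q k j)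

theorem RootSpan.sub {k : Bool} {m n : ℤ} {a b : QPos F q} (ha : RootSpan k m n a)
    (hb : RootSpan k m n b) : RootSpan k m n (a - b) := by
  rw [sub_eq_add_neg, ← neg_one_smul F b]
  exact ha.add (hb.smul _)

theorem RootSpan.congr {k : Bool} {m n m' n' : ℤ} {a : QPos F q} (ha : RootSpan k m n a)
    (hm : m = m') (hn : n = n') : RootSpan k m' n' a := hm ▸ hn ▸ ha

theorem rootVector_one_mul_gen (k : Bool) :
    rootVector F q k 1 * gen F q k = gen F q k * rootVector F q k 1 - rootVector F q k 2 := by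
  simp only [rootVector]
  abel

/-- The orbit of `v` under the `q`-commutator with the generator `k`, where `v` has weight `d`. -/
def raise (k : Bool) (d : ℕ) (v : QPos F q) : ℕ → QPos F q
  | 0 => v
  | i + 1 => gen F q k * raise k d v i - ((q ^ 2) ^ (d + i))⁻¹ • (raise k d v i * gen F q k)

theorem raise_succ (k : Bool) (d : ℕ) (v : QPos F q) (i : ℕ) : raise k d v (i + 1) =
    gen F q k * raise k d v i - ((q ^ 2) ^ (d + i))⁻¹ • (raise k d v i * gen F q k) := rfl

theorem proj_raise {k : Bool} {d : ℕ} {v : QPos F q} {γ : Bool → ℤ}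
    (hv : proj γ v = v) (i : ℕ) :
    proj (γ + i • simpleRoot k) (raise k d v i) = raise k d v i := by
  induction i with
  | zero => simpa [raise] using hv
  | succ i ih =>
    have : γ + (i + 1) • simpleRoot k - simpleRoot k = γ + i • simpleRoot k := by
      rw [add_smul, one_smul]; abel
    rw [raise, map_sub, map_smul, proj_gen_mul, proj_mul_gen, this, ih]

variable [IsGenericParam q]

theorem rootVector_zero_mul_gen (k : Bool) :
    rootVector F q k 0 * gen F q k =
      (q ^ 2)⁻¹ • (gen F q k * rootVector F q k 0 - rootVector F q k 1) := by
  have h : q ^ 2 ≠ 0 := sq_ne_zero'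
  simp [rootVector, smul_smul, h]

/-- This is the Serre relation: the root string closes up after three vectors, so each root vector
has degree at most two in `k`. -/
theorem rootVector_two_mul_gen (k : Bool) :
    rootVector F q k 2 * gen F q k = q ^ 2 • (gen F q k * rootVector F q k 2) := by
  have h0 : q ≠ 0 := IsGenericParam.ne_zero
  have h2 : q ^ 2 ≠ 1 := IsGenericParam.sq_ne_one
  have hs := qSerre_gen (F := F) (q := q) k
  have : rootVector F q k 2 * gen F q k - q ^ 2 • (gen F q k * rootVector F q k 2) =
      -(q ^ 2) • qSerre q (gen F q k) (gen F q (!k)) := by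
    simp only [rootVector, qSerre, qInt_three h0 h2, pow_succ, pow_zero, one_mul, mul_sub, sub_mul,
      smul_mul_assoc, mul_smul_comm, smul_sub, smul_smul, mul_assoc, smul_add]
    match_scalars <;> field_simp <;> ring
  rw [hs, smul_zero, sub_eq_zero] at this
  exact this

theorem RootSpan.mul_gen {k : Bool} {m n : ℤ} {a : QPos F q} (ha : RootSpan k m n a) :
    RootSpan k (m + 1) n (a * gen F q k) := by
  induction ha with
  | zero => rw [zero_mul]; exact .zero _ _
  | add _ _ ha hb => rw [add_mul]; exact ha.add hb
  | smul c _ ha => rw [smul_mul_assoc]; exact ha.smul c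
  | pow a => rw [← pow_succ]; exact (RootSpan.pow (a + 1)).congr (by simp) rfl
  | @mul_root m n j a h ha =>
    rw [mul_assoc]
    fin_cases j
    · change RootSpan k (m + (0 : ℕ) + 1) _ (a * (rootVector F q k 0 * _))
      rw [rootVector_zero_mul_gen, mul_smul_comm, mul_sub, ← mul_assoc]
      exact .smul _ (((ha.mul_root 0).congr (by simp) rfl).sub ((h.mul_root 1).congr (by simp) rfl))
    · change RootSpan k (m + (1 : ℕ) + 1) _ (a * (rootVector F q k 1 * _))
      rw [rootVector_one_mul_gen, mul_sub, ← mul_assoc]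
      exact ((ha.mul_root 1).congr (by simp) rfl).sub
        ((h.mul_root 2).congr (by simp; ring) rfl)
    · change RootSpan k (m + (2 : ℕ) + 1) _ (a * (rootVector F q k 2 * _))
      rw [rootVector_two_mul_gen, mul_smul_comm, ← mul_assoc]
      exact .smul _ ((ha.mul_root 2).congr (by simp; ring) rfl)

theorem rootSpan_proj (k : Bool) (γ : Bool → ℤ) (w : QPos F q) :
    RootSpan k (γ k) (γ (!k)) (proj γ w) := by
  induction w using induction_right generalizing γ with
  | one =>
    rw [proj_one]
    split_ifs with h
    · subst h
      simpa using RootSpan.pow (F := F) (q := q) (k := k) 0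
    · exact .zero _ _
  | add a b ha hb => rw [map_add]; exact (ha γ).add (hb γ)
  | smul c a ha => rw [map_smul]; exact (ha γ).smul c
  | mul_gen i a ha =>
    rw [proj_mul_gen]
    have h := ha (γ - simpleRoot i)
    by_cases hi : i = k
    · subst hi
      exact h.mul_gen.congr (by simp) (by simp)
    · obtain rfl : i = !k := by cases i <;> cases k <;> simp_all
      exact (h.mul_root 0).congr (by simp) (by simp)

theorem derL_rootVector (k : Bool) (j : Fin 3) : derL k (rootVector F q k j) = 0 := by
  have h : q ^ 2 ≠ 0 := sq_ne_zero'
  have h1 : derL k (gen F q (!k)) = 0 := by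
    have := derL_gen_mul (F := F) (q := q) k (!k) 1
    simpa [single_eq] using this
  have h2 : derL k (gen F q k) = 1 := by
    have := derL_gen_mul (F := F) (q := q) k k 1
    simpa [single_eq] using this
  have h3 : derL k (rootVector F q k 1) = 0 := by
    simp [rootVector, derL_mul, h1, h2, rootTwist_not, smul_smul, h]
  have h4 : twist k (rootVector F q k 1) = rootVector F q k 1 := by
    simp [rootVector, rootTwist_not, rootTwist_self, smul_smul, h]
  fin_cases j
  · exact h1
  · exact h3
  · change derL k (gen F q k * rootVector F q k 1 - rootVector F q k 1 * gen F q k) = 0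
    rw [map_sub, derL_mul, derL_mul, h2, h3, h4]
    simp

/-- The operator whose eigenspaces separate the powers of the generator `k`. -/
def powerOp (k : Bool) : Module.End F (QPos F q) := LinearMap.mulLeft F (gen F q k) * derL k

theorem powerOp_apply (k : Bool) (w : QPos F q) : powerOp k w = gen F q k * derL k w := rfl

theorem powerOp_pow (k : Bool) (a : ℕ) :
    powerOp k (gen F q k ^ a) = (∑ i ∈ Finset.range a, (q ^ 2) ^ i) • gen F q k ^ a := by
  rw [powerOp_apply]
  induction a with
  | zero => simp
  | succ a ih =>
    rw [pow_succ', derL_gen_mul, ih, rootTwist_self, geom_sum_succ, single_eq, if_pos rfl, one_smul,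
      mul_add, mul_smul_comm, mul_smul_comm, smul_smul, add_smul, one_smul, add_comm]

theorem geom_sum_ne_zero {a : ℕ} (ha : 0 < a) : (∑ i ∈ Finset.range a, (q ^ 2) ^ i) ≠ 0 := by
  intro h
  have := geom_sum_mul (q ^ 2) a
  rw [h, zero_mul, eq_comm, sub_eq_zero, ← pow_mul] at this
  exact IsGenericParam.pow_ne_one _ (by omega) this

/-- Root vectors are killed by `derL k`, so multiplying by them on the right preserves eigenspaces
of `powerOp k`; the eigenvalue depends only on the exponent `a` of the leading power. Each root
vector uses at most two of the degree in `k`, whence the bound on `a`. -/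
theorem RootSpan.mem_iSup_eigenspace {k : Bool} {m n : ℤ} {w : QPos F q} (h : RootSpan k m n w) :
    w ∈ ⨆ a : ℕ, ⨆ _ : m ≤ a + 2 * n,
      (powerOp k).eigenspace (∑ i ∈ Finset.range a, (q ^ 2) ^ i) := by
  induction h with
  | zero => exact zero_mem _
  | add _ _ ha hb => exact add_mem ha hb
  | smul c _ ha => exact Submodule.smul_mem _ c ha
  | pow a =>
    refine Submodule.mem_iSup_of_mem a (Submodule.mem_iSup_of_mem (by simp) ?_)
    exact Module.End.mem_eigenspace_iff.2 (powerOp_pow k a)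
  | @mul_root m n j w h ih =>
    have hle : (⨆ a : ℕ, ⨆ _ : m ≤ a + 2 * n,
        (powerOp (q := q) k).eigenspace (∑ i ∈ Finset.range a, (q ^ 2) ^ i)) ≤
        (⨆ a : ℕ, ⨆ _ : m + (j : ℕ) ≤ a + 2 * (n + 1),
        (powerOp k).eigenspace (∑ i ∈ Finset.range a, (q ^ 2) ^ i)).comap
          (LinearMap.mulRight F (rootVector F q k j)) := by
      refine iSup₂_le fun a ha z hz => ?_
      have hj := j.is_lt
      refine Submodule.mem_iSup_of_mem a (Submodule.mem_iSup_of_mem (by omega) ?_)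
      rw [Module.End.mem_eigenspace_iff, powerOp_apply] at hz ⊢
      rw [LinearMap.mulRight_apply, derL_mul, derL_rootVector, mul_zero, add_zero, ← mul_assoc, hz,
        smul_mul_assoc]
    exact hle ih

/-- A left derivation is injective in degrees that are large in its own direction. -/
theorem RootSpan.eq_zero {k : Bool} {m n : ℤ} {w : QPos F q} (h : RootSpan k m n w)
    (hmn : 2 * n < m) (hw : derL k w = 0) : w = 0 := by
  have h0 : w ∈ (powerOp k).eigenspace (0 : F) := by
    rw [Module.End.mem_eigenspace_iff, powerOp_apply, hw, mul_zero, zero_smul]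
  have h1 := h.mem_iSup_eigenspace
  have hd := (powerOp (F := F) (q := q) k).eigenspaces_iSupIndep 0
  refine Submodule.disjoint_def.1 hd w h0 ?_
  have hle : (⨆ a : ℕ, ⨆ _ : m ≤ a + 2 * n,
      (powerOp (q := q) k).eigenspace (∑ i ∈ Finset.range a, (q ^ 2) ^ i)) ≤
      ⨆ μ : F, ⨆ _ : μ ≠ 0, (powerOp (q := q) k).eigenspace μ :=
    iSup₂_le fun a ha =>
      -- As `2 * n < m`, only exponents `a > 0` occur, and their eigenvalues are nonzero.
      le_iSup₂_of_le (∑ i ∈ Finset.range a, (q ^ 2) ^ i) (geom_sum_ne_zero (by omega)) le_rfl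
  exact hle h1

/-- The coefficients that describe the lowering of `raise`. -/
def lowerCoeff (q : F) (d : ℕ) : ℕ → F
  | 0 => 0
  | i + 1 => 1 - (((q ^ 2) ^ (d + i))⁻¹) ^ 2 + (q ^ 2)⁻¹ * lowerCoeff q d i

/-- Solving the recursion shows the coefficient to be a product of two `q`-integers, up to nonzero
factors; the form is cleared of denominators. -/
theorem lowerCoeff_eq (d i : ℕ) :
    lowerCoeff q d (i + 1) * ((q ^ 2 - 1) * (q ^ 2) ^ (2 * i)) =
      ((q ^ 2) ^ (i + 1) - 1) * ((q ^ 2) ^ i - (((q ^ 2) ^ d)⁻¹) ^ 2) := by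
  have h : q ^ 2 ≠ 0 := sq_ne_zero'
  induction i with
  | zero => simp [lowerCoeff]; ring
  | succ i ih =>
    rw [lowerCoeff]
    generalize q ^ 2 = t at h ih
    have h1 : ((t ^ (d + (i + 1)))⁻¹) ^ 2 * t ^ (2 * (i + 1)) = ((t ^ d)⁻¹) ^ 2 := by
      field_simp
      ring
    have h2 : t⁻¹ * t = 1 := inv_mul_cancel₀ h
    generalize t⁻¹ = s at h2 ih ⊢
    generalize ((t ^ (d + (i + 1)))⁻¹) ^ 2 = r at h1 ih ⊢
    generalize ((t ^ d)⁻¹) ^ 2 = r' at h1 ih ⊢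
    linear_combination t * ih - (t - 1) * h1 +
      lowerCoeff q d (i + 1) * (t - 1) * t ^ (2 * i) * t * h2

theorem lowerCoeff_ne_zero {d : ℕ} (hd : 0 < d) (i : ℕ) : lowerCoeff q d (i + 1) ≠ 0 := by
  intro h
  have := lowerCoeff_eq (q := q) d i
  rw [h, zero_mul, eq_comm, mul_eq_zero, sub_eq_zero, sub_eq_zero] at this
  rcases this with h | h
  · rw [← pow_mul] at h
    exact IsGenericParam.pow_ne_one _ (by omega) h
  · have h' : (q ^ 2) ^ i * ((q ^ 2) ^ d) ^ 2 = 1 := by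
      rw [h, ← mul_pow, inv_mul_cancel₀ (pow_ne_zero _ sq_ne_zero'), one_pow]
    rw [← pow_mul, ← pow_mul, ← pow_mul, ← pow_add] at h'
    exact IsGenericParam.pow_ne_one _ (by omega) h'

section

variable {k : Bool} {d : ℕ} {v : QPos F q} {γ : Bool → ℤ}

theorem twist_raise (hv : proj γ v = v) (hd : γ k = γ (!k) + d) (i : ℕ) :
    twist k (raise k d v i) = (q ^ 2) ^ (d + i) • raise k d v i := by
  rw [← proj_raise hv i, twist_proj]
  congr 1
  rw [← zpow_natCast (q ^ 2) (d + i)]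
  congr 1
  simp [hd]
  ring

theorem twist_not_raise (hv : proj γ v = v) (hd : γ k = γ (!k) + d) (i : ℕ) :
    twist (!k) (raise k d v i) = ((q ^ 2) ^ (d + i))⁻¹ • raise k d v i := by
  rw [← proj_raise hv i, twist_proj]
  congr 1
  rw [← zpow_natCast (q ^ 2) (d + i), ← zpow_neg]
  congr 1
  simp [hd]
  ring

theorem derL_gen_self (k : Bool) : derL k (gen F q k) = 1 := by
  have := derL_gen_mul (F := F) (q := q) k k 1
  simpa [single_eq] using this

theorem derR_gen_self (k : Bool) : derR k (gen F q k) = 1 := by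
  have := derR_gen_mul (F := F) (q := q) k k 1
  simpa [single_eq] using this

/-- The coefficient in `raise` is the inverse of the `twist k` eigenvalue, so the two contributions
of `derL k` cancel. -/
theorem derL_raise (hv : proj γ v = v) (hd : γ k = γ (!k) + d) (he : derL k v = 0) (i : ℕ) :
    derL k (raise k d v i) = 0 := by
  induction i with
  | zero => exact he
  | succ i ih =>
    have h : (q ^ 2) ^ (d + i) ≠ 0 := pow_ne_zero _ sq_ne_zero'
    rw [raise, map_sub, map_smul, derL_mul, derL_mul, ih, twist_raise hv hd, derL_gen_self, mul_zero,
      zero_mul, one_mul, mul_one, add_zero, zero_add, smul_smul, inv_mul_cancel₀ h, one_smul,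
      sub_self]

theorem derR_raise (hv : proj γ v = v) (hd : γ k = γ (!k) + d) (hf : derR k v = 0) (i : ℕ) :
    derR k (raise k d v (i + 1)) = lowerCoeff q d (i + 1) • raise k d v i := by
  have step : ∀ i, derR k (raise k d v (i + 1)) =
      (1 - (((q ^ 2) ^ (d + i))⁻¹) ^ 2) • raise k d v i +
      (q ^ 2)⁻¹ • (gen F q k * derR k (raise k d v i)) -
      ((q ^ 2) ^ (d + i))⁻¹ • (derR k (raise k d v i) * gen F q k) := by
    intro i
    rw [raise, map_sub, map_smul, derR_mul, derR_mul, twist_not_raise hv hd, derR_gen_self, one_mul,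
      mul_one, twist_gen, rootTwist_not', smul_mul_assoc]
    module
  induction i with
  | zero => rw [step, raise, hf, lowerCoeff, lowerCoeff]; simp
  | succ i ih =>
    have h : q ^ 2 ≠ 0 := sq_ne_zero'
    have hL : lowerCoeff q d (i + 1 + 1) =
      1 - (((q ^ 2) ^ (d + (i + 1)))⁻¹) ^ 2 + (q ^ 2)⁻¹ * lowerCoeff q d (i + 1) := rfl
    rw [step, ih, hL, raise_succ]
    simp only [smul_mul_assoc, mul_smul_comm, smul_smul, smul_sub]
    rw [show d + (i + 1) = (d + i) + 1 from rfl, pow_succ]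
    generalize q ^ 2 = t at h
    match_scalars <;> field_simp
    all_goals ring

/-- A homogeneous lowest weight vector of positive weight vanishes. -/
theorem eq_zero_of_lowest_weight (hv : proj γ v = v) (hd : γ k = γ (!k) + d) (hd0 : 0 < d)
    (he : derL k v = 0) (hf : derR k v = 0) : v = 0 := by
  have hN : ∃ N, raise k d v N = 0 := by
    -- After this many steps the degree in `k` exceeds twice the other degree, where `derL k` is
    -- injective; if the integer is negative this already holds at step zero.
    refine ⟨(2 * γ (!k) - γ k + 1).toNat, ?_⟩
    have h := rootSpan_proj k (γ + (2 * γ (!k) - γ k + 1).toNat • simpleRoot k)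
      (raise k d v (2 * γ (!k) - γ k + 1).toNat)
    rw [proj_raise hv] at h
    refine h.eq_zero ?_ (derL_raise hv hd he _)
    simp
    omega
  obtain ⟨N, hN⟩ := hN
  induction N with
  | zero => exact hN
  | succ N ih =>
    apply ih
    -- Lowering a vanishing vector of the orbit forces the preceding one to vanish, down to `v`
    -- itself.
    have := derR_raise hv hd hf N
    rw [hN, map_zero, eq_comm, smul_eq_zero] at this
    exact this.resolve_left (lowerCoeff_ne_zero hd0 N)

end

end Sl2

/-! ### The common kernel of the left derivations. -/

section Irreducible

variable [IsGenericParam q]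

theorem eq_counit_of_lengthLT (n : ℕ) : ∀ v : QPos F q, LengthLT n v → (∀ k, derL k v = 0) →
    v = counit v • 1 := by
  induction n with
  | zero => intro v hv _; rw [hv.eq_zero]; simp
  | succ n ih =>
    suffices H : ∀ v : QPos F q, LengthLT (n + 1) v → (∀ k, derL k v = 0) → counit v = 0 →
        v = 0 by
      intro v hv h
      rw [← sub_eq_zero]
      apply H
      · rw [sub_eq_add_neg, ← neg_smul]
        exact hv.add (.smul _ (.one n))
      · intro k; simp [h]
      · simp
    intro v hv h h0
    have hs := antipode_eq_neg (coproduct_eq_of_derL_eq_zero ih hv h h0) h0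
    have hf : ∀ k, derR k v = 0 := by
      intro k
      -- The right derivative is shorter and still in the common kernel, hence a scalar, and that
      -- scalar is the constant term of `derL k v = 0`.
      have := ih (derR k v) (hv.skewDer _ _) fun j => by rw [derL_derR, h, map_zero, smul_zero]
      rw [this, counit_derR, h, map_zero, zero_smul]
    rw [eq_counit_of_proj_eq_zero v, h0, zero_smul]
    intro γ hγ
    by_contra hne
    have key : ∀ k, γ k ≤ γ (!k) := by
      intro k
      by_contra! hlt
      refine hne (eq_zero_of_lowest_weight (k := k) (d := (γ k - γ (!k)).toNat) (proj_proj γ v)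
        (by omega) (by omega) ?_ ?_)
      · rw [derL_proj, h, map_zero]
      · rw [derR_proj, hf, map_zero]
    have h1 := key true
    have h2 := key false
    simp only [Bool.not_true, Bool.not_false] at h1 h2
    -- The squared antipode fixes `v`, hence each of its components, so its scalar on a nonzero
    -- component must be `1`.
    have hss := antipode_antipode_proj γ v
    rw [← proj_antipode, ← proj_antipode, hs, map_neg, hs, neg_neg, eq_comm] at hss
    have h3 : (q ^ 2) ^ ((γ false - γ true) ^ 2 - (γ false + γ true)) = 1 := by
      by_contra hc
      apply hne
      have : ((q ^ 2) ^ ((γ false - γ true) ^ 2 - (γ false + γ true)) - 1) • proj γ v = 0 := by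
        rw [sub_smul, one_smul, hss, sub_self]
      exact (smul_eq_zero.1 this).resolve_left (sub_ne_zero.2 hc)
    have h4 : γ false = γ true := le_antisymm h2 h1
    have h5 : 0 ≤ γ true := by
      by_contra! hlt
      exact hne (proj_eq_zero true hlt v)
    have h6 : γ true ≠ 0 := by
      intro h6
      apply hγ
      ext j
      cases j <;> simp [h4, h6]
    rw [h4, sub_self, zero_pow two_ne_zero, zero_sub, zpow_neg, inv_eq_one,
      ← Int.toNat_of_nonneg (by omega : 0 ≤ γ true + γ true), zpow_natCast, ← pow_mul] at h3
    exact IsGenericParam.pow_ne_one _ (by omega) h3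

/-- The left derivations have only scalars as common kernel. -/
theorem eq_counit_of_derL_eq_zero {v : QPos F q} (h : ∀ k, derL k v = 0) : v = counit v • 1 := by
  obtain ⟨n, hn⟩ := exists_lengthLT v
  exact eq_counit_of_lengthLT n v hn h

/-- Nondegeneracy in terms of coefficients: an element is determined by the constant terms of its
iterated left derivatives. -/
theorem eq_zero_of_counit_derList {n : ℕ} : ∀ {v : QPos F q}, LengthLT n v →
    (∀ l, counit (derList l v) = 0) → v = 0 := by
  induction n with
  | zero => intro v hv _; exact hv.eq_zero
  | succ n ih =>
    intro v hv h
    rw [eq_counit_of_derL_eq_zero fun k => ih (hv.skewDer _ _) fun l => h (k :: l)]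
    rw [show counit v = 0 from h [], zero_smul]

end Irreducible


variable {F : Type u} [Field F] {q : F}

/-! ### The skew derivations representing `x_1` and `x_3`. -/

/-- The values on generators of the skew derivations by which `x_1` and `x_3` act. -/
def nilCoeff (q : F) (k j : Bool) : F := if j = k then 1 - q ^ 2 else 1 - (q ^ 2)⁻¹

/-- The endomorphism that multiplies words of length `n` by `q ^ n`. -/
def scale : QPos F q →ₐ[F] QPos F q :=
  lift (fun i => q • gen F q i) fun i => by rw [qSerre_smul, qSerre_gen, smul_zero]

@[simp]
theorem scale_gen (i : Bool) : scale (gen F q i) = q • gen F q i := by simp [scale]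

variable [IsGenericParam q]

/-- The action of `x_1` and `x_3` on the positive part. -/
def lower (k : Bool) : QPos F q →ₗ[F] QPos F q := skewDer k (nilCoeff q k)

@[simp]
theorem lower_one (k : Bool) : lower k (1 : QPos F q) = 0 := skewDer_one _ _

theorem lower_gen_mul (k j : Bool) (w : QPos F q) :
    lower k (gen F q j * w) = nilCoeff q k j • w + rootTwist q k j • (gen F q j * lower k w) :=
  skewDer_gen_mul _ _ _ _

/-- Since `1 - q ^ (-2) = -q ^ (-2) * (1 - q ^ 2)`, vanishing of `lower i v` is exactly the relation
between left and right derivatives that the rotation argument needs. -/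
theorem eq_counit_of_lower_eq_zero {v : QPos F q} (h : ∀ k, lower k v = 0) :
    v = counit v • 1 := by
  have hrot : ∀ i, derL i v = (q ^ 2)⁻¹ • derR (!i) v := by
    intro i
    have h1 := h i
    have h0 : q ^ 2 ≠ 0 := sq_ne_zero'
    have h2 : 1 - q ^ 2 ≠ 0 := sub_ne_zero.2 IsGenericParam.sq_ne_one.symm
    rw [lower, skewDer_eq, nilCoeff, nilCoeff, if_pos rfl, if_neg (by simp)] at h1
    rw [← sub_eq_zero]
    refine (smul_eq_zero.1 ?_).resolve_left h2
    rw [← h1]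
    have h3 : q ≠ 0 := IsGenericParam.ne_zero
    match_scalars <;> field_simp
    ring
  apply eq_counit_of_derL_eq_zero
  intro k
  obtain ⟨n, hn⟩ := exists_lengthLT (derL k v)
  -- Passing to `derL k v` makes every word `k :: l` nonempty, as the rotation argument requires.
  exact eq_zero_of_counit_derList hn fun l => counit_derList_eq_zero hrot (k :: l) (by simp)

end QPos

theorem iSupIndep.eq_of_le_of_iSup_eq_top {F : Type u} [Field F] {ι : Type w} {M : Type v}
    [AddCommGroup M] [Module F M]
    {S T : ι → Submodule F M} (hS : iSupIndep S) (hle : T ≤ S) (hT : ⨆ i, T i = ⊤) : S = T := by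
  funext i
  refine le_antisymm (fun y hy => ?_) (hle i)
  have hy' : y ∈ T i ⊔ ⨆ (j) (_ : j ≠ i), T j := by
    rw [← iSup_split_single, hT]; trivial
  obtain ⟨a, ha, b, hb, rfl⟩ := Submodule.mem_sup.1 hy'
  have hb' : b ∈ S i := by simpa using Submodule.sub_mem _ hy (hle i ha)
  have hb0 : b = 0 := Submodule.disjoint_def.1 (hS i) b hb' (iSup₂_mono (fun j _ => hle j) hb)
  rwa [hb0, add_zero]

/-! ### The square algebra: generators, words and orbit maps. -/

namespace SquareAlgebra

variable {F : Type u} [Field F] {q : F}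

theorem adjoin_x : Algebra.adjoin F (Set.range (x F q)) = ⊤ := by
  have h := congrArg (Subalgebra.map (RingQuot.mkAlgHom F (SquareRel F q)))
    (FreeAlgebra.adjoin_range_ι F (ZMod 4))
  rw [AlgHom.map_adjoin, ← Set.range_comp, Algebra.map_top] at h
  rw [show x F q = RingQuot.mkAlgHom F (SquareRel F q) ∘ FreeAlgebra.ι F from rfl, h]
  exact (AlgHom.range_eq_top _).2 (RingQuot.mkAlgHom_surjective F _)

theorem qSerre_x (i : ZMod 4) : qSerre q (x F q i) (x F q (i + 2)) = 0 := by
  have := RingQuot.mkAlgHom_rel F (SquareRel.qSerre (F := F) (q := q) i)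
  rw [map_zero] at this
  rw [← this]
  simp only [qSerre, x, map_sub, map_add, map_mul, map_pow, map_smul]

theorem qWeyl_x (i : ZMod 4) : (q - q⁻¹)⁻¹ • (q • (x F q i * x F q (i + 1)) -
    q⁻¹ • (x F q (i + 1) * x F q i)) = 1 := by
  have := RingQuot.mkAlgHom_rel F (SquareRel.qWeyl (F := F) (q := q) i)
  rw [map_one] at this
  rw [← this]
  simp only [x, map_sub, map_mul, map_smul]

/-- The index of the raising generator attached to a generator of the positive part. -/
def up : Bool → ZMod 4
  | false => 0
  | true => 2

/-- The index of the lowering generator attached to a generator of the positive part. -/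
def down : Bool → ZMod 4
  | false => 1
  | true => 3

theorem forall_index {P : ZMod 4 → Prop} (hu : ∀ i, P (up i)) (hd : ∀ i, P (down i)) (i : ZMod 4) :
    P i := by
  fin_cases i
  · exact hu false
  · exact hd false
  · exact hu true
  · exact hd true

theorem up_add_two (i : Bool) : up i + 2 = up (!i) := by cases i <;> decide

theorem down_add_two (i : Bool) : down i + 2 = down (!i) := by cases i <;> decide

theorem isNILVector_iff {V : Type v} [AddCommGroup V] [Module (SquareAlgebra F q) V]
    {ξ : V} : IsNILVector F q ξ ↔ (∀ k, x F q (down k) • ξ = 0) ∧ ξ ≠ 0 := by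
  rw [IsNILVector, Bool.forall_bool, and_assoc]
  rfl

theorem wordVectors_zero {V : Type v} [AddCommGroup V] [Module (SquareAlgebra F q) V]
    (ξ : V) : wordVectors F q ξ 0 = {ξ} := by
  ext y
  simp [wordVectors]

theorem mem_wordVectors_succ {V : Type v} [AddCommGroup V] [Module (SquareAlgebra F q) V]
    {ξ y : V} {n : ℕ} : y ∈ wordVectors F q ξ (n + 1) ↔
    ∃ i, ∃ z ∈ wordVectors F q ξ n, y = x F q (up i) • z := by
  constructor
  · rintro ⟨f, hf, rfl⟩
    have : ∃ i, f 0 = x F q (up i) := by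
      rcases hf 0 with h | h
      · exact ⟨false, h⟩
      · exact ⟨true, h⟩
    obtain ⟨i, hi⟩ := this
    refine ⟨i, _, ⟨fun j => f j.succ, fun j => hf _, rfl⟩, ?_⟩
    rw [List.ofFn_succ, List.prod_cons, hi, mul_smul]
  · rintro ⟨i, _, ⟨f, hf, rfl⟩, rfl⟩
    refine ⟨Fin.cons (x F q (up i)) f, ?_, ?_⟩
    · intro j
      refine Fin.cases ?_ (fun j => ?_) j
      · rw [Fin.cons_zero]
        cases i
        · exact Or.inl rfl
        · exact Or.inr rfl
      · rw [Fin.cons_succ]; exact hf j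
    · rw [List.ofFn_succ, List.prod_cons, mul_smul]
      simp only [Fin.cons_zero, Fin.cons_succ]

theorem IsNILDecomposition.isNILVector {V : Type v} [AddCommGroup V] [Module F V]
    [Module (SquareAlgebra F q) V] {S : ℕ → Submodule F V} (hS : IsNILDecomposition F q S)
    {y : V} (hy : y ∈ S 0) (h0 : y ≠ 0) : IsNILVector F q y :=
  ⟨(Submodule.mem_bot F).1 (hS.x_one_smul_mem 0 y hy),
    (Submodule.mem_bot F).1 (hS.x_three_smul_mem 0 y hy), h0⟩

theorem smul_comm_scalar {V : Type v} [AddCommGroup V] [Module F V] [Module (SquareAlgebra F q) V]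
    [IsScalarTower F (SquareAlgebra F q) V] (c : F) (a : SquareAlgebra F q) (y : V) :
    a • c • y = c • a • y := by
  rw [← one_smul (SquareAlgebra F q) y, ← smul_assoc c, ← smul_assoc, smul_eq_mul, mul_smul_comm,
    mul_one, one_smul, smul_assoc]

/-- The inclusion of the positive part. -/
def ofQPos : QPos F q →ₐ[F] SquareAlgebra F q :=
  QPos.lift (fun i => x F q (up i)) fun i => by rw [← up_add_two, qSerre_x]

theorem ofQPos_gen (i : Bool) : ofQPos (QPos.gen F q i) = x F q (up i) := QPos.lift_gen _ _ _

section Basics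

variable {V : Type v} [AddCommGroup V] [Module F V] [Module (SquareAlgebra F q) V]
  [IsScalarTower F (SquareAlgebra F q) V]

/-- The orbit map of a vector. -/
def orbit (ξ : V) : QPos F q →ₗ[F] V where
  toFun w := (ofQPos w : SquareAlgebra F q) • ξ
  map_add' a b := by rw [map_add, add_smul]
  map_smul' c a := by rw [map_smul, smul_assoc, RingHom.id_apply]

theorem orbit_one (ξ : V) : orbit (q := q) ξ (1 : QPos F q) = ξ := by
  change (ofQPos 1 : SquareAlgebra F q) • ξ = ξ
  rw [map_one, one_smul]

theorem orbit_gen_mul (ξ : V) (i : Bool) (w : QPos F q) :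
    orbit ξ (QPos.gen F q i * w) = x F q (up i) • orbit ξ w := by
  change (ofQPos _ : SquareAlgebra F q) • ξ = _ • (ofQPos w : SquareAlgebra F q) • ξ
  rw [map_mul, ofQPos_gen, mul_smul]

/-- The action of an element of the square algebra as an `F`-linear map. -/
def smulHom (V : Type v) [AddCommGroup V] [Module F V] [Module (SquareAlgebra F q) V]
    [IsScalarTower F (SquareAlgebra F q) V] (a : SquareAlgebra F q) : V →ₗ[F] V where
  toFun y := a • y
  map_add' := smul_add a
  map_smul' c y := smul_comm_scalar c a y

theorem x_up_smul_mem_span (ξ : V) (i : Bool) (n : ℕ) {y : V}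
    (hy : y ∈ Submodule.span F (wordVectors F q ξ n)) :
    x F q (up i) • y ∈ Submodule.span F (wordVectors F q ξ (n + 1)) := by
  have : Submodule.span F (wordVectors F q ξ n) ≤
      (Submodule.span F (wordVectors F q ξ (n + 1))).comap (smulHom V (x F q (up i))) := by
    rw [Submodule.span_le]
    intro z hz
    exact Submodule.subset_span (mem_wordVectors_succ.2 ⟨i, z, hz, rfl⟩)
  exact this hy

end Basics

theorem sub_inv_ne_zero [IsGenericParam q] : q - q⁻¹ ≠ 0 := by
  have h0 : q ≠ 0 := IsGenericParam.ne_zero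
  have h2 : q ^ 2 ≠ 1 := IsGenericParam.sq_ne_one
  intro h
  apply h2
  rw [sub_eq_zero] at h
  rw [pow_two]
  nth_rw 2 [h]
  exact mul_inv_cancel₀ h0

/-- The two solved forms of the `q`-Weyl relation. -/
theorem qWeyl_iff [IsGenericParam q] {R : Type v} [Ring R] [Algebra F R] (a b : R) :
    (q - q⁻¹)⁻¹ • (q • (a * b) - q⁻¹ • (b * a)) = 1 ↔
      b * a = q ^ 2 • (a * b) + (1 - q ^ 2) • (1 : R) := by
  have h0 : q ≠ 0 := IsGenericParam.ne_zero
  have hd : q - q⁻¹ ≠ 0 := sub_inv_ne_zero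
  have e : b * a - (q ^ 2 • (a * b) + (1 - q ^ 2) • (1 : R)) = -(q * (q - q⁻¹)) •
      ((q - q⁻¹)⁻¹ • (q • (a * b) - q⁻¹ • (b * a)) - 1) := by
    rw [smul_sub, smul_smul, neg_mul, mul_assoc, mul_inv_cancel₀ hd, mul_one]
    match_scalars <;> field_simp
    ring
  rw [← sub_eq_zero, ← sub_eq_zero (a := b * a), e, smul_eq_zero,
    or_iff_right (neg_ne_zero.2 (mul_ne_zero h0 hd))]

theorem qWeyl_iff' [IsGenericParam q] {R : Type v} [Ring R] [Algebra F R] (a b : R) :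
    (q - q⁻¹)⁻¹ • (q • (a * b) - q⁻¹ • (b * a)) = 1 ↔
      a * b = (q ^ 2)⁻¹ • (b * a) + (1 - (q ^ 2)⁻¹) • (1 : R) := by
  have h0 : q ≠ 0 := IsGenericParam.ne_zero
  rw [qWeyl_iff]
  constructor <;> intro h <;> rw [h] <;> match_scalars <;> field_simp <;> ring

variable [IsGenericParam q]

theorem x_down_mul_x_up (k j : Bool) : x F q (down k) * x F q (up j) =
    QPos.nilCoeff q k j • 1 + rootTwist q k j • (x F q (up j) * x F q (down k)) := by
  rw [add_comm]
  cases k <;> cases j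
  · exact (qWeyl_iff _ _).1 (qWeyl_x 0)
  · exact (qWeyl_iff' _ _).1 (qWeyl_x 1)
  · exact (qWeyl_iff' _ _).1 (qWeyl_x 3)
  · exact (qWeyl_iff _ _).1 (qWeyl_x 2)

/-! ### The square algebra acting on the positive part. -/

/-- The operators on the positive part that represent the generators. -/
def op (F : Type u) [Field F] (q : F) [IsGenericParam q] (i : ZMod 4) :
    Module.End F (QPos F q) :=
  if i = 0 then LinearMap.mulLeft F (QPos.gen F q false)
  else if i = 1 then QPos.lower false
  else if i = 2 then LinearMap.mulLeft F (QPos.gen F q true)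
  else QPos.lower true

theorem op_up (i : Bool) : op F q (up i) = LinearMap.mulLeft F (QPos.gen F q i) := by
  cases i <;> rfl

theorem op_down (i : Bool) : op F q (down i) = QPos.lower i := by
  cases i <;> rfl

theorem op_down_mul_op_up (k j : Bool) : op F q (down k) * op F q (up j) =
    rootTwist q k j • (op F q (up j) * op F q (down k)) + QPos.nilCoeff q k j • 1 := by
  rw [op_up, op_down]
  ext w
  simp [QPos.lower_gen_mul, add_comm]

/-- For the lowering operators, the Serre expression commutes up to scalars with left multiplication
by generators and kills `1`, hence is zero. -/
theorem qSerre_op (i : ZMod 4) : qSerre q (op F q i) (op F q (i + 2)) = 0 := by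
  have h0 : q ≠ 0 := IsGenericParam.ne_zero
  have h2 : q ^ 2 ≠ 1 := IsGenericParam.sq_ne_one
  revert i
  apply forall_index
  · intro i
    rw [up_add_two, op_up, op_up]
    have := map_qSerre (q := q) (Algebra.lmul F (QPos F q)) (QPos.gen F q i) (QPos.gen F q (!i))
    rw [QPos.qSerre_gen, map_zero] at this
    exact this.symm
  · intro i
    rw [down_add_two]
    have key : ∀ j, ∃ c : F, qSerre q (op F q (down i)) (op F q (down !i)) * op F q (up j) =
        c • (op F q (up j) * qSerre q (op F q (down i)) (op F q (down !i))) := by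
      intro j
      have h1 := op_down_mul_op_up (F := F) (q := q) i j
      have h3 := op_down_mul_op_up (F := F) (q := q) (!i) j
      by_cases hij : j = i
      · subst hij
        rw [QPos.rootTwist_self] at h1
        rw [QPos.rootTwist_not'] at h3
        exact ⟨_, qSerre_mul_skew h0 h2 h1 h3⟩
      · obtain rfl : j = !i := by cases i <;> cases j <;> simp_all
        rw [QPos.rootTwist_not] at h1
        rw [QPos.rootTwist_self] at h3
        exact ⟨_, qSerre_mul_skew' h0 h2 h1 h3⟩
    apply QPos.linearMap_ext
    · simp [qSerre, op_down, pow_succ]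
    · intro j a ha
      obtain ⟨c, hc⟩ := key j
      have := LinearMap.congr_fun hc a
      rw [Module.End.mul_apply, op_up, LinearMap.mulLeft_apply] at this
      rw [this, LinearMap.smul_apply, Module.End.mul_apply, ha]
      simp

/-- The representation of the square algebra on the positive part. -/
def rep : SquareAlgebra F q →ₐ[F] Module.End F (QPos F q) :=
  RingQuot.liftAlgHom F ⟨FreeAlgebra.lift F (op F q), by
    intro a b hab
    cases hab with
    | qWeyl i =>
      simp only [map_smul, map_sub, map_mul, FreeAlgebra.lift_ι_apply, map_one]
      fin_cases i
      · exact (qWeyl_iff _ _).2 (op_down_mul_op_up false false)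
      · exact (qWeyl_iff' _ _).2 (op_down_mul_op_up false true)
      · exact (qWeyl_iff _ _).2 (op_down_mul_op_up true true)
      · exact (qWeyl_iff' _ _).2 (op_down_mul_op_up true false)
    | qSerre i =>
      simp only [map_smul, map_sub, map_add, map_mul, map_pow, FreeAlgebra.lift_ι_apply, map_zero]
      exact qSerre_op i⟩

theorem rep_x (i : ZMod 4) : rep (x F q i) = op F q i :=
  (RingQuot.liftAlgHom_mkAlgHom_apply F _ _ _).trans (FreeAlgebra.lift_ι_apply _ _)

instance : Module (SquareAlgebra F q) (QPos F q) :=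
  Module.compHom _ (rep (F := F) (q := q)).toRingHom

theorem smul_qPos_def (a : SquareAlgebra F q) (w : QPos F q) : a • w = rep a w := rfl

instance : IsScalarTower F (SquareAlgebra F q) (QPos F q) where
  smul_assoc c a w := by rw [smul_qPos_def, smul_qPos_def, map_smul]; rfl

theorem x_up_smul (i : Bool) (w : QPos F q) : x F q (up i) • w = QPos.gen F q i * w := by
  rw [smul_qPos_def, rep_x, op_up, LinearMap.mulLeft_apply]

theorem x_down_smul (i : Bool) (w : QPos F q) : x F q (down i) • w = QPos.lower i w := by
  rw [smul_qPos_def, rep_x, op_down]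

theorem isNILModule_qPos : IsNILModule F q (QPos F q) := by
  refine ⟨1, isNILVector_iff.2 ⟨fun k => by rw [x_down_smul, QPos.lower_one], ?_⟩, ?_⟩
  · intro h
    have := congrArg (QPos.counit (F := F) (q := q)) h
    simp at this
  · intro W hW
    rw [eq_top_iff]
    rintro w -
    induction w using QPos.induction_left with
    | one => exact hW
    | add a b ha hb => exact W.add_mem ha hb
    | smul c a ha => rw [← one_smul (SquareAlgebra F q) a, ← smul_assoc]; exact W.smul_mem _ ha
    | gen_mul i a ha => rw [← x_up_smul]; exact W.smul_mem _ ha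

/-! ### Orbit maps of NIL vectors and uniqueness of NIL modules. -/

section Orbit

variable {V : Type v} [AddCommGroup V] [Module F V] [Module (SquareAlgebra F q) V]
  [IsScalarTower F (SquareAlgebra F q) V]

theorem orbit_lower {ξ : V} (hξ : IsNILVector F q ξ) (k : Bool) (w : QPos F q) :
    orbit ξ (QPos.lower k w) = x F q (down k) • orbit ξ w := by
  induction w using QPos.induction_left with
  | one => rw [QPos.lower_one, map_zero, orbit_one, (isNILVector_iff.1 hξ).1]
  | add a b ha hb => simp only [map_add, ha, hb, smul_add]
  | smul c a ha => rw [map_smul, map_smul, map_smul, ha, smul_comm_scalar]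
  | gen_mul i a ha =>
    rw [QPos.lower_gen_mul, map_add, map_smul, map_smul, orbit_gen_mul, ha, orbit_gen_mul,
      ← mul_smul (x F q (down k)), x_down_mul_x_up, add_smul, smul_assoc, smul_assoc, one_smul,
      mul_smul]

theorem orbit_smul {ξ : V} (hξ : IsNILVector F q ξ) (a : SquareAlgebra F q) (w : QPos F q) :
    orbit ξ (a • w) = a • orbit ξ w := by
  have ha : a ∈ Algebra.adjoin F (Set.range (x F q)) := by rw [adjoin_x]; trivial
  induction ha using Algebra.adjoin_induction generalizing w with
  | mem _ h =>
    obtain ⟨i, rfl⟩ := h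
    revert i
    apply forall_index
    · intro i; rw [x_up_smul, orbit_gen_mul]
    · intro i; rw [x_down_smul, orbit_lower hξ]
  | algebraMap c => rw [algebraMap_smul, algebraMap_smul, map_smul]
  | add a b _ _ ha hb => rw [add_smul, add_smul, map_add, ha, hb]
  | mul a b _ _ ha hb => rw [mul_smul, mul_smul, ha, hb]

/-- If `w` is in the kernel, so are the shorter elements `lower k w`, which vanish by induction.
Then `w` is a scalar, which is zero because `ξ ≠ 0`. -/
theorem orbit_injective {ξ : V} (hξ : IsNILVector F q ξ) :
    Function.Injective (orbit (q := q) ξ) := by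
  have key : ∀ n, ∀ w : QPos F q, QPos.LengthLT n w → orbit ξ w = 0 → w = 0 := by
    intro n
    induction n with
    | zero => intro w hw _; exact hw.eq_zero
    | succ n ih =>
      intro w hw h
      have h1 := QPos.eq_counit_of_lower_eq_zero fun k =>
        ih (QPos.lower k w) (hw.skewDer _ _) (by rw [orbit_lower hξ, h, smul_zero])
      rw [h1, map_smul, orbit_one, smul_eq_zero] at h
      rw [h1, h.resolve_right (isNILVector_iff.1 hξ).2, zero_smul]
  rw [← LinearMap.ker_eq_bot, LinearMap.ker_eq_bot']
  intro w hw
  obtain ⟨n, hn⟩ := QPos.exists_lengthLT w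
  exact key n w hn hw

/-- The orbit map as a homomorphism of modules over the square algebra. -/
def orbitHom {ξ : V} (hξ : IsNILVector F q ξ) : QPos F q →ₗ[SquareAlgebra F q] V where
  toFun := orbit ξ
  map_add' := map_add _
  map_smul' := orbit_smul hξ

theorem orbit_surjective {ξ : V} (hξ : IsNILVector F q ξ) (hg : IsGeneratedBy F q ξ) :
    Function.Surjective (orbit (q := q) ξ) := by
  have := hg (LinearMap.range (orbitHom hξ)) ⟨1, orbit_one ξ⟩
  exact fun y => LinearMap.range_eq_top.1 this y

/-- A NIL module is isomorphic to the positive part. -/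
noncomputable def orbitEquiv {ξ : V} (hξ : IsNILVector F q ξ) (hg : IsGeneratedBy F q ξ) :
    QPos F q ≃ₗ[SquareAlgebra F q] V :=
  LinearEquiv.ofBijective (orbitHom hξ) ⟨orbit_injective hξ, orbit_surjective hξ hg⟩

/-- The preimage of `ζ` under the orbit map is killed by both `lower k`, hence is a scalar. -/
theorem IsNILVector.exists_smul_eq {ξ ζ : V} (hξ : IsNILVector F q ξ) (hg : IsGeneratedBy F q ξ)
    (hζ : IsNILVector F q ζ) : ∃ c : F, c ≠ 0 ∧ ζ = c • ξ := by
  obtain ⟨w, rfl⟩ := orbit_surjective hξ hg ζ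
  rw [isNILVector_iff] at hζ
  have h1 := QPos.eq_counit_of_lower_eq_zero (v := w) fun k => orbit_injective hξ (by
    rw [orbit_lower hξ, hζ.1, map_zero])
  have h2 : orbit ξ w = QPos.counit w • ξ := by
    conv_lhs => rw [h1, map_smul, orbit_one]
  refine ⟨_, fun h0 => hζ.2 ?_, h2⟩
  rw [h2, h0, zero_smul]

theorem IsNILVector.isGeneratedBy {ξ ζ : V} (hξ : IsNILVector F q ξ) (hg : IsGeneratedBy F q ξ)
    (hζ : IsNILVector F q ζ) : IsGeneratedBy F q ζ := by
  obtain ⟨c, hc, rfl⟩ := IsNILVector.exists_smul_eq hξ hg hζ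
  intro W hW
  apply hg
  have := W.smul_mem (algebraMap F (SquareAlgebra F q) c⁻¹) hW
  rwa [algebraMap_smul, smul_smul, inv_mul_cancel₀ hc, one_smul] at this

end Orbit

/-! ### The decomposition by word length and its uniqueness. -/

section Words

variable {V : Type v} [AddCommGroup V] [Module F V] [Module (SquareAlgebra F q) V]

variable [IsScalarTower F (SquareAlgebra F q) V]

theorem x_down_smul_mem_span {ξ : V} (hξ : IsNILVector F q ξ) (k : Bool) (n : ℕ) {y : V}
    (hy : y ∈ Submodule.span F (wordVectors F q ξ n)) :
    x F q (down k) • y ∈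
      prevSubspace (fun n => Submodule.span F (wordVectors F q ξ n)) n := by
  induction n generalizing y with
  | zero =>
    rw [wordVectors_zero, Submodule.mem_span_singleton] at hy
    obtain ⟨c, rfl⟩ := hy
    rw [smul_comm_scalar, (isNILVector_iff.1 hξ).1, smul_zero]
    exact Submodule.zero_mem _
  | succ n ih =>
    have : Submodule.span F (wordVectors F q ξ (n + 1)) ≤
        (Submodule.span F (wordVectors F q ξ n)).comap (smulHom V (x F q (down k))) := by
      rw [Submodule.span_le]
      intro z hz
      obtain ⟨i, z, hz₁, rfl⟩ := mem_wordVectors_succ.1 hz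
      have hz' : z ∈ Submodule.span F (wordVectors F q ξ n) := Submodule.subset_span hz₁
      change x F q (down k) • x F q (up i) • z ∈ Submodule.span F (wordVectors F q ξ n)
      rw [← mul_smul, x_down_mul_x_up, add_smul, smul_assoc, smul_assoc, one_smul, mul_smul]
      refine Submodule.add_mem _ (Submodule.smul_mem _ _ hz') (Submodule.smul_mem _ _ ?_)
      have h1 := ih hz'
      cases n with
      | zero =>
        rw [(Submodule.mem_bot F).1 h1, smul_zero]
        exact Submodule.zero_mem _
      | succ n => exact x_up_smul_mem_span ξ i n h1
    exact this hy

theorem iSup_span_wordVectors {ξ : V} (hξ : IsNILVector F q ξ) (hg : IsGeneratedBy F q ξ) :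
    ⨆ n, Submodule.span F (wordVectors F q ξ n) = ⊤ := by
  rw [eq_top_iff]
  rintro y -
  obtain ⟨w, rfl⟩ := orbit_surjective hξ hg y
  induction w using QPos.induction_left with
  | one =>
    refine Submodule.mem_iSup_of_mem 0 (Submodule.subset_span ?_)
    rw [orbit_one, wordVectors_zero]
    rfl
  | add a b ha hb => rw [map_add]; exact Submodule.add_mem _ ha hb
  | smul c a ha => rw [map_smul]; exact Submodule.smul_mem _ _ ha
  | gen_mul i a ha =>
    rw [orbit_gen_mul]
    have : (⨆ n, Submodule.span F (wordVectors F q ξ n)) ≤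
        (⨆ n, Submodule.span F (wordVectors F q ξ n)).comap (smulHom V (x F q (up i))) :=
      iSup_le fun n z hz => Submodule.mem_iSup_of_mem (n + 1) (x_up_smul_mem_span ξ i n hz)
    exact this ha

/-- Transporting `QPos.scale` along the orbit map gives an operator with eigenvalue `q ^ n` on words
of length `n`; these are distinct as `q` is not a root of unity. -/
theorem iSupIndep_span_wordVectors {ξ : V} (hξ : IsNILVector F q ξ) (hg : IsGeneratedBy F q ξ) :
    iSupIndep fun n => Submodule.span F (wordVectors F q ξ n) := by
  let e : QPos F q ≃ₗ[F] V :=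
    LinearEquiv.ofBijective (orbit (q := q) ξ) ⟨orbit_injective hξ, orbit_surjective hξ hg⟩
  let f : Module.End F V := e.conj (QPos.scale (q := q)).toLinearMap
  have hf : ∀ w : QPos F q, f (orbit ξ w) = orbit ξ (QPos.scale w) := by
    intro w
    change e (QPos.scale (e.symm (e w))) = _
    rw [e.symm_apply_apply]
    rfl
  have hinj : Function.Injective fun n : ℕ => q ^ n := by
    have h0 : q ≠ 0 := IsGenericParam.ne_zero
    intro m n hmn
    wlog hle : m ≤ n generalizing m n
    · exact (this hmn.symm (by omega)).symm
    by_contra hne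
    apply IsGenericParam.pow_ne_one (q := q) (n - m) (by omega)
    rw [pow_sub₀ _ h0 hle, ← show q ^ m = q ^ n from hmn]
    exact mul_inv_cancel₀ (pow_ne_zero _ h0)
  refine (f.eigenspaces_iSupIndep.comp hinj).mono fun n => ?_
  rw [Submodule.span_le]
  intro y hy
  suffices H : ∃ w : QPos F q, y = orbit ξ w ∧ QPos.scale w = q ^ n • w by
    obtain ⟨w, rfl, hw⟩ := H
    exact Module.End.mem_eigenspace_iff.2 (by rw [hf, hw, map_smul])
  induction n generalizing y with
  | zero =>
    rw [wordVectors_zero] at hy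
    refine ⟨1, ?_, by simp⟩
    rw [orbit_one]
    exact hy
  | succ n ih =>
    obtain ⟨i, z, hz, rfl⟩ := mem_wordVectors_succ.1 hy
    obtain ⟨w, rfl, hw⟩ := ih hz
    refine ⟨QPos.gen F q i * w, (orbit_gen_mul ξ i w).symm, ?_⟩
    rw [map_mul, hw, QPos.scale_gen, smul_mul_assoc, mul_smul_comm, smul_smul, pow_succ']

theorem isNILDecomposition_span_wordVectors {ξ : V} (hξ : IsNILVector F q ξ)
    (hg : IsGeneratedBy F q ξ) :
    IsNILDecomposition F q fun n => Submodule.span F (wordVectors F q ξ n) where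
  zero_ne_bot := by
    rw [wordVectors_zero, Ne, Submodule.span_singleton_eq_bot]
    exact (isNILVector_iff.1 hξ).2
  isInternal := (DirectSum.isInternal_submodule_iff_iSupIndep_and_iSup_eq_top _).2
    ⟨iSupIndep_span_wordVectors hξ hg, iSup_span_wordVectors hξ hg⟩
  x_zero_smul_mem n _ hy := x_up_smul_mem_span ξ false n hy
  x_one_smul_mem n _ hy := x_down_smul_mem_span hξ false n hy
  x_two_smul_mem n _ hy := x_up_smul_mem_span ξ true n hy
  x_three_smul_mem n _ hy := x_down_smul_mem_span hξ true n hy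

/-- Nonzero vectors of `S 0` are NIL because the index cannot drop below zero, and NIL vectors are
unique up to scalars. -/
theorem IsNILDecomposition.mem_zero {S : ℕ → Submodule F V} (hS : IsNILDecomposition F q S)
    {ξ : V} (hξ : IsNILVector F q ξ) (hg : IsGeneratedBy F q ξ) : ξ ∈ S 0 := by
  obtain ⟨y, hy, h0⟩ := Submodule.exists_mem_ne_zero_of_ne_bot hS.zero_ne_bot
  obtain ⟨c, hc, rfl⟩ := IsNILVector.exists_smul_eq hξ hg
    (IsNILDecomposition.isNILVector hS hy h0)
  exact (Submodule.smul_mem_iff _ hc).1 hy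

/-- Raising from `ξ ∈ S 0` puts the word spans inside `S`; since they already sum to the whole
space, independence of `S` forces equality. -/
theorem IsNILDecomposition.eq_span_wordVectors {S : ℕ → Submodule F V}
    (hS : IsNILDecomposition F q S) {ξ : V} (hξ : IsNILVector F q ξ) (hg : IsGeneratedBy F q ξ) :
    S = fun n => Submodule.span F (wordVectors F q ξ n) := by
  have hI := (DirectSum.isInternal_submodule_iff_iSupIndep_and_iSup_eq_top _).1 hS.isInternal
  refine hI.1.eq_of_le_of_iSup_eq_top (fun n => ?_) (iSup_span_wordVectors hξ hg)
  rw [Submodule.span_le]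
  induction n with
  | zero =>
    rw [wordVectors_zero, Set.singleton_subset_iff]
    exact IsNILDecomposition.mem_zero hS hξ hg
  | succ n ih =>
    intro y hy
    obtain ⟨i, z, hz, rfl⟩ := mem_wordVectors_succ.1 hy
    cases i
    · exact hS.x_zero_smul_mem n z (ih hz)
    · exact hS.x_two_smul_mem n z (ih hz)

end Words

end SquareAlgebra

theorem mainTheorem7 {F : Type u} [Field F] (q : F) (hq0 : q ≠ 0)
    (hq : ∀ n : ℕ, 0 < n → q ^ n ≠ 1) :
    -- a NIL module exists
    (∃ (U : Type u) (_ : AddCommGroup U) (_ : Module F U) (_ : Module (SquareAlgebra F q) U)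
      (_ : IsScalarTower F (SquareAlgebra F q) U), IsNILModule F q U) ∧
    ∀ (U : Type v) [AddCommGroup U] [Module F U] [Module (SquareAlgebra F q) U]
      [IsScalarTower F (SquareAlgebra F q) U], IsNILModule F q U →
      -- it is unique up to isomorphism
      (∀ (V : Type w) [AddCommGroup V] [Module F V] [Module (SquareAlgebra F q) V]
        [IsScalarTower F (SquareAlgebra F q) V], IsNILModule F q V →
        Nonempty (U ≃ₗ[SquareAlgebra F q] V)) ∧
      -- it has a unique decomposition, described as follows
      (∃! S : ℕ → Submodule F U, IsNILDecomposition F q S) ∧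
      ∀ S : ℕ → Submodule F U, IsNILDecomposition F q S →
        Module.finrank F (S 0) = 1 ∧
        (∀ ξ : U, (ξ ∈ S 0 ∧ ξ ≠ 0) ↔ IsNILVector F q ξ) ∧
        (∀ ξ : U, IsNILVector F q ξ → IsGeneratedBy F q ξ) ∧
        ∀ ξ : U, IsNILVector F q ξ →
          ∀ n : ℕ, S n = Submodule.span F (wordVectors F q ξ n) := by
  have : IsGenericParam q := ⟨hq0, hq⟩
  refine ⟨⟨QPos F q, inferInstance, inferInstance, inferInstance, inferInstance,
    SquareAlgebra.isNILModule_qPos⟩, ?_⟩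
  intro U _ _ _ _ ⟨ξ, hξ, hg⟩
  refine ⟨?_, ⟨_, SquareAlgebra.isNILDecomposition_span_wordVectors hξ hg, fun S hS =>
    SquareAlgebra.IsNILDecomposition.eq_span_wordVectors hS hξ hg⟩, fun S hS => ⟨?_, ?_, ?_, ?_⟩⟩
  · rintro V _ _ _ _ ⟨ζ, hζ, hg'⟩
    exact ⟨(SquareAlgebra.orbitEquiv hξ hg).symm.trans (SquareAlgebra.orbitEquiv hζ hg')⟩
  · rw [congrFun (SquareAlgebra.IsNILDecomposition.eq_span_wordVectors hS hξ hg) 0,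
      SquareAlgebra.wordVectors_zero]
    exact finrank_span_singleton hξ.2.2
  · intro ζ
    exact ⟨fun h => SquareAlgebra.IsNILDecomposition.isNILVector hS h.1 h.2, fun h =>
      ⟨SquareAlgebra.IsNILDecomposition.mem_zero hS h
        (SquareAlgebra.IsNILVector.isGeneratedBy hξ hg h), h.2.2⟩⟩
  · exact fun ζ hζ => SquareAlgebra.IsNILVector.isGeneratedBy hξ hg hζ
  · intro ζ hζ n
    rw [SquareAlgebra.IsNILDecomposition.eq_span_wordVectors hS hζ
      (SquareAlgebra.IsNILVector.isGeneratedBy hξ hg hζ)]
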